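/- Let $(R,\mathfrak m)$ be a Noetherian local ring and $M$ a finitely generated $R$-module of dimension $d>0$. Let $\mathbf x=x_1,\dots,x_r$ $(0\le r\le d)$ be a partial system of parameters of $M$, i.e. elements of $\mathfrak m$ with $\dim M=r+\dim M/(\mathbf x)M$. Assume that $\mathbf x$ is amenable to $M$, i.e. the Koszul homology modules $\mathrm H_i(\mathbf x;M)$ have finite length for all $i>0$, and that $\mathbf x$ is a $d$-sequence relative to $M$, i.e. $$(x_1,\dots,x_{i-1})M:_M x_ix_j=(x_1,\dots,x_{i-1})M:_M x_j\qquad\text{for all }1\le i\le j\le r .$$ Write $\lambda$ for length and $\mathrm H^0_{\mathfrak m}(N)$ for the submodule of the elements of $N$ killed by a power of $\mathfrak m$, and put $h_i=\lambda(\mathrm H_i(\mathbf x;M))$ for $i>0$ and $h_0=\lambda(\mathrm H^0_{\mathfrak m}(\mathrm H_0(\mathbf x;M)))$. Let $$\mathrm H=\mathrm H^0_{\mathfrak m}(\mathrm{gr}_{(\mathbf x)}(M)),\qquad \mathrm{gr}_{(\mathbf x)}(M)=\bigoplus_{n\ge0}(\mathbf x)^nM/(\mathbf x)^{n+1}M,$$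 with its natural grading $\mathrm H=\bigoplus_{n\ge0}\mathrm H_n$, be the $\mathbf j$-transform of $M$. Then $h_0$ and all $\lambda(\mathrm H_n)$ are finite, and the following hold. (1) The Hilbert series of $\mathrm H$ is $$\sum_{n\ge0}\lambda(\mathrm H_n)\,t^n=\frac{\sum_{i=0}^r(-1)^ih_it^i}{(1-t)^r}.$$ For all large $n$ the function $n\mapsto\sum_{k\le n}\lambda(\mathrm H_k)$ agrees with a polynomial $$\sum_{i=0}^r(-1)^i\,\mathrm j_i(\mathbf x;M)\binom{n+r-i}{r-i}$$ (the $\mathbf j$-polynomial) with uniquely determined integers $\mathrm j_i(\mathbf x;M)$ (the $\mathbf j$-coefficients), and for $0\le i\le r$ $$\mathrm j_i(\mathbf x;M)=\sum_{k=i}^r(-1)^kh_k\binom ki .$$ In particular $\mathrm j_0(\mathbf x;M)=\sum_{k=0}^r(-1)^kh_k$ and, if $r\ge1$, $\mathrm j_1(\mathbf x;M)=\sum_{k=1}^r(-1)^k\,k\,h_k$. (2) $\mathbf x$ is an $M$-regular sequence if and only if $\mathrm j_1(\mathbf x;M)=\dots=\mathrm j_r(\mathbf x;M)=0$. -/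

import Mathlib

open Filter

noncomputable section

namespace JTransform

section Koszul

variable {R : Type*} [CommRing R] {r : ℕ} (x : Fin r → R)
  (M : Type*) [AddCommGroup M] [Module R M]

/-- The `i`-th chain module `⋀^i R^r ⊗ M` of the Koszul complex: the function `f` stands for
`∑_S e_S ⊗ f S`, where `S` runs over the `i`-element subsets of the index set and
`e_S = e_{s₁} ∧ ⋯ ∧ e_{sᵢ}` for `S = {s₁ < ⋯ < sᵢ}`. -/
abbrev KoszulChain (r : ℕ) (M : Type*) (i : ℕ) : Type _ :=
  {S : Finset (Fin r) // S.card = i} → M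

/-- `insert j T` as a subset with one more element. -/
def insertIdx {i : ℕ} (T : {S : Finset (Fin r) // S.card = i}) (j : {j : Fin r // j ∉ T.1}) :
    {S : Finset (Fin r) // S.card = i + 1} :=
  ⟨insert j.1 T.1, by rw [Finset.card_insert_of_notMem j.2, T.2]⟩

/-- The Koszul differential
`d (e_S ⊗ m) = ∑_{j ∈ S} (-1)^{#{k ∈ S | k < j}} e_{S \ j} ⊗ x_j m`,
written through the coefficient at `e_T`. -/
def koszulD (i : ℕ) : KoszulChain r M (i + 1) →ₗ[R] KoszulChain r M i where
  toFun f T := ∑ j : {j : Fin r // j ∉ T.1},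
    (-1 : R) ^ (T.1.filter (· < j.1)).card • x j.1 • f (insertIdx T j)
  map_add' f g := by
    funext T
    simp only [Pi.add_apply, smul_add, Finset.sum_add_distrib]
  map_smul' a f := by
    funext T
    simp only [Pi.smul_apply, RingHom.id_apply, Finset.smul_sum]
    refine Finset.sum_congr rfl fun j _ => ?_
    rw [smul_comm (x j.1) a, smul_comm _ a]

lemma koszul_sign {r : ℕ} (T : Finset (Fin r)) (j k : Fin r) (hj : j ∉ T)
    (hjk : j < k) :
    ((insert j T).filter (· < k)).card = (T.filter (· < k)).card + 1 ∧
    ((insert k T).filter (· < j)).card = (T.filter (· < j)).card := by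
  constructor
  · rw [Finset.filter_insert, if_pos hjk, Finset.card_insert_of_notMem (by simp [hj])]
  · rw [Finset.filter_insert, if_neg (not_lt.2 hjk.le)]

/-- The Koszul complex is a complex. -/
theorem koszulD_comp (i : ℕ) (f : KoszulChain r M (i + 1 + 1)) :
    koszulD x M i (koszulD x M (i + 1) f) = 0 := by
  funext T
  simp only [koszulD, LinearMap.coe_mk, AddHom.coe_mk, Pi.zero_apply, Finset.smul_sum]
  rw [Finset.sum_sigma' Finset.univ (fun _ => Finset.univ)]
  have hk (p : (j : {j : Fin r // j ∉ T.1}) × {k : Fin r // k ∉ (insertIdx T j).1}) :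
      p.2.1 ≠ p.1.1 ∧ p.2.1 ∉ T.1 := by
    have := p.2.2
    simpa [insertIdx, not_or] using this
  refine Finset.sum_involution
    (fun p _ => ⟨⟨p.2.1, (hk p).2⟩, ⟨p.1.1, by
      have h := hk p
      have h' := p.1.2
      simp only [insertIdx, Finset.mem_insert, not_or]
      exact ⟨h.1.symm, h'⟩⟩⟩) ?_ ?_ ?_ ?_
  · intro p _
    have hS : insertIdx (insertIdx T ⟨p.2.1, (hk p).2⟩) ⟨p.1.1, by
        have h := hk p
        have h' := p.1.2
        simp only [insertIdx, Finset.mem_insert, not_or]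
        exact ⟨h.1.symm, h'⟩⟩ = insertIdx (insertIdx T p.1) p.2 := by
      apply Subtype.ext
      simp only [insertIdx]
      exact Finset.insert_comm _ _ _
    dsimp only
    rw [hS]
    generalize f (insertIdx (insertIdx T p.1) p.2) = m
    simp only [smul_smul, ← add_smul]
    convert zero_smul R m
    simp only [insertIdx]
    rcases lt_or_gt_of_ne (hk p).1 with h | h
    · obtain ⟨h1, h2⟩ := koszul_sign T.1 p.2.1 p.1.1 (hk p).2 h
      rw [h1, h2, pow_succ]
      ring
    · obtain ⟨h1, h2⟩ := koszul_sign T.1 p.1.1 p.2.1 p.1.2 h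
      rw [h1, h2, pow_succ]
      ring
  · intro p _ _ h
    have := congrArg (fun q => q.1.1) h
    exact (hk p).1 this
  · intro p _
    simp
  · intro p _
    rfl

/-- The cycles of the Koszul complex in degree `i` (everything in degree `0`). -/
def koszulCycles : (i : ℕ) → Submodule R (KoszulChain r M i)
  | 0 => ⊤
  | i + 1 => LinearMap.ker (koszulD x M i)

/-- The Koszul homology module `H_i(x; M)`: cycles modulo boundaries. -/
abbrev KoszulHomology (i : ℕ) : Type _ :=
  koszulCycles x M i ⧸ (LinearMap.range (koszulD x M i)).submoduleOf (koszulCycles x M i)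

/-- `x` is a `d`-sequence relative to `M`:
`(x_1, …, x_{i-1})M :_M x_i x_j = (x_1, …, x_{i-1})M :_M x_j` for all `i ≤ j`. -/
def IsDSequence : Prop :=
  ∀ i j : Fin r, i ≤ j → ∀ m : M,
    (x i * x j) • m ∈ (Ideal.span (x '' {k | k < i}) • ⊤ : Submodule R M) ↔
      x j • m ∈ (Ideal.span (x '' {k | k < i}) • ⊤ : Submodule R M)

/-- `x` is amenable to `M`: all the `H_i(x; M)` with `i > 0` have finite length. -/
def IsAmenable : Prop :=
  ∀ i : ℕ, 0 < i → IsFiniteLength R (KoszulHomology x M i)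

end Koszul

section Graded

variable {R : Type*} [CommRing R]

/-- The homogeneous component `I^n M / I^{n+1} M` of `gr_I(M)`. -/
abbrev GrComponent (I : Ideal R) (M : Type*) [AddCommGroup M] [Module R M] (n : ℕ) : Type _ :=
  (I ^ n • ⊤ : Submodule R M) ⧸
    (I ^ (n + 1) • ⊤ : Submodule R M).submoduleOf (I ^ n • ⊤ : Submodule R M)

/-- The associated graded module `gr_I(M) = ⨁ I^n M / I^{n+1} M`. -/
abbrev Gr (I : Ideal R) (M : Type*) [AddCommGroup M] [Module R M] : Type _ :=
  DirectSum ℕ (GrComponent I M)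

variable [IsLocalRing R]

/-- `H^0_𝔪(N)`: the elements of `N` killed by a power of the maximal ideal. -/
def localH0 (R : Type*) [CommRing R] [IsLocalRing R] (N : Type*) [AddCommGroup N] [Module R N] :
    Submodule R N where
  carrier := {z | ∃ l : ℕ, ∀ a ∈ IsLocalRing.maximalIdeal R ^ l, a • z = 0}
  zero_mem' := ⟨0, fun a _ => smul_zero a⟩
  add_mem' := by
    rintro y z ⟨k, hk⟩ ⟨l, hl⟩
    refine ⟨max k l, fun a ha => ?_⟩
    rw [smul_add, hk a (Ideal.pow_le_pow_right (le_max_left k l) ha),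
      hl a (Ideal.pow_le_pow_right (le_max_right k l) ha), add_zero]
  smul_mem' := by
    rintro c z ⟨k, hk⟩
    exact ⟨k, fun a ha => by rw [smul_comm, hk a ha, smul_zero]⟩

/-- The `𝐣`-transform `H_I(M) = H^0_𝔪(gr_I(M))`. -/
def jTransform (I : Ideal R) (M : Type*) [AddCommGroup M] [Module R M] : Submodule R (Gr I M) :=
  localH0 R (Gr I M)

/-- The homogeneous component of degree `n` of the `𝐣`-transform, inside `I^n M / I^{n+1} M`. -/
def jComponent (I : Ideal R) (M : Type*) [AddCommGroup M] [Module R M] (n : ℕ) :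
    Submodule R (GrComponent I M n) :=
  (jTransform I M).comap (DirectSum.lof R ℕ (GrComponent I M) n)

/-- The components of the `𝐣`-transform are the modules `H^0_𝔪(I^n M / I^{n+1} M)`. -/
theorem jComponent_eq (I : Ideal R) (M : Type*) [AddCommGroup M] [Module R M] (n : ℕ) :
    jComponent I M n = localH0 R (GrComponent I M n) := by
  ext z
  refine exists_congr fun l => forall₂_congr fun a _ => ?_
  rw [← map_smul, ← map_zero (DirectSum.lof R ℕ (GrComponent I M) n)]
  exact (DirectSum.of_injective (β := GrComponent I M) n).eq_iff

/-- The Hilbert series `∑_n λ([H_I(M)]_n) t^n` of the `𝐣`-transform. -/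
def jHilbertSeries (I : Ideal R) (M : Type*) [AddCommGroup M] [Module R M] : PowerSeries ℤ :=
  PowerSeries.mk fun n => ((Module.length R (jComponent I M n)).toNat : ℤ)

/-- The `𝐣`-function `ψ(n) = ∑_{k ≤ n} λ([H_I(M)]_k)`. -/
def jFunction (I : Ideal R) (M : Type*) [AddCommGroup M] [Module R M] (n : ℕ) : ℕ :=
  ∑ k ∈ Finset.range (n + 1), (Module.length R (jComponent I M k)).toNat

variable {r : ℕ} (x : Fin r → R) (M : Type*) [AddCommGroup M] [Module R M]

/-- `x` is a partial system of parameters of `M`. -/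
def IsPartialSOP : Prop :=
  (∀ i, x i ∈ IsLocalRing.maximalIdeal R) ∧
    Module.supportDim R M =
      r + Module.supportDim R (M ⧸ (Ideal.span (Set.range x) • ⊤ : Submodule R M))

/-- The lengths `h_0 = λ(H^0_𝔪(H_0(x; M)))` and `h_i = λ(H_i(x; M))` for `i > 0`. -/
def koszulLength (i : ℕ) : ℕ :=
  if i = 0 then (Module.length R (localH0 R (KoszulHomology x M 0))).toNat
  else (Module.length R (KoszulHomology x M i)).toNat

/-- `∑_{i ≤ r} (-1)^i j_i binom(n + r - i, r - i)` is the Hilbert polynomial of the `𝐣`-function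
of `M` relative to the ideal `(x)`; that is, the two agree for all large `n`. The sequence `j` is
extended by `0` beyond `r`. -/
def IsJCoeffs (j : ℕ → ℤ) : Prop :=
  (∀ i, r < i → j i = 0) ∧
  ∀ᶠ n : ℕ in atTop, (jFunction (Ideal.span (Set.range x)) M n : ℤ) =
    ∑ i ∈ Finset.range (r + 1), (-1) ^ i * j i * ((n + r - i).choose (r - i) : ℤ)

open Classical in
/-- The `𝐣`-coefficients `j_i(x; M)`, i.e. the coefficients of the `𝐣`-polynomial. -/
def jCoeff : ℕ → ℤ :=
  if h : ∃ j : ℕ → ℤ, IsJCoeffs x M j then h.choose else 0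

lemma binom_indep (s : ℕ) (c : ℕ → ℤ) (N : ℕ)
    (h : ∀ n, N ≤ n → ∑ i ∈ Finset.range (s + 1), c i * ((n + i).choose i : ℤ) = 0) :
    ∀ i ≤ s, c i = 0 := by
  induction s generalizing c N with
  | zero =>
    intro i hi
    obtain rfl : i = 0 := by omega
    simpa using h N le_rfl
  | succ s ih =>
    have key : ∀ i ≤ s, c (i + 1) = 0 := by
      refine ih (fun i => c (i + 1)) (N + 1) fun n hn => ?_
      obtain ⟨m, rfl⟩ : ∃ m, n = m + 1 := ⟨n - 1, by omega⟩
      have h1 := h (m + 1) (by omega)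
      have h0 := h m (by omega)
      rw [Finset.sum_range_succ'] at h0 h1
      have h2 := congrArg₂ (· - ·) h1 h0
      simp only [add_zero, Nat.choose_zero_right, Nat.cast_one, mul_one, add_sub_add_right_eq_sub,
        ← Finset.sum_sub_distrib, sub_self] at h2
      rw [← h2]
      refine Finset.sum_congr rfl fun i _ => ?_
      have e1 : m + 1 + (i + 1) = (m + 1 + i) + 1 := by ring
      have e2 : m + (i + 1) = m + 1 + i := by ring
      rw [e1, e2, Nat.choose_succ_succ]
      push_cast
      ring
    intro i hi
    rcases i with _ | i
    · have h0 := h N le_rfl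
      rw [Finset.sum_range_succ'] at h0
      rw [Finset.sum_eq_zero (fun i hi => by
        rw [key i (by have := Finset.mem_range.1 hi; omega), zero_mul])] at h0
      simpa using h0
    · exact key i (by omega)

/-- The `𝐣`-polynomial determines its coefficients. -/
theorem IsJCoeffs.unique {x : Fin r → R} {M : Type*} [AddCommGroup M] [Module R M] {j j' : ℕ → ℤ}
    (h : IsJCoeffs x M j) (h' : IsJCoeffs x M j') : j = j' := by
  obtain ⟨N, hN⟩ := eventually_atTop.1 (h.2.and h'.2)
  have key := binom_indep r (fun i => (-1) ^ (r - i) * (j (r - i) - j' (r - i))) N (by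
    intro n hn
    obtain ⟨h1, h2⟩ := hN n hn
    rw [← Finset.sum_range_reflect] at h1 h2
    rw [← sub_eq_zero.2 (h1.symm.trans h2), ← Finset.sum_sub_distrib]
    refine Finset.sum_congr rfl fun i hi => ?_
    have hi := Finset.mem_range.1 hi
    have e1 : r + 1 - 1 - i = r - i := by omega
    have e2 : r - (r - i) = i := by omega
    have e3 : n + r - (r - i) = n + i := by omega
    rw [e1, e2, e3]
    ring)
  funext i
  rcases le_or_gt i r with hi | hi
  · have := key (r - i) (by omega)
    rw [show r - (r - i) = i by omega] at this
    rcases mul_eq_zero.1 this with h0 | h0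
    · exact absurd h0 (pow_ne_zero _ (by norm_num))
    · linarith
  · rw [h.1 i hi, h'.1 i hi]

/-- `jCoeff` is the sequence of coefficients of the `𝐣`-polynomial. -/
theorem IsJCoeffs.jCoeff_eq {x : Fin r → R} {M : Type*} [AddCommGroup M] [Module R M] {j : ℕ → ℤ}
    (h : IsJCoeffs x M j) : jCoeff x M = j := by
  have hex : ∃ j : ℕ → ℤ, IsJCoeffs x M j := ⟨j, h⟩
  rw [jCoeff, dif_pos hex]
  exact hex.choose_spec.unique h

end Graded

end JTransform

end

/-! Write I = (x) and A = 0 :_M x₀, and induct on the length of x, passing to the tail of x on M /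
x₀M, again a d-sequence (`IsDSequence.tail`). The d-sequence condition gives x_j A = 0 for all j, A
∩ IM = 0 and x₀M ∩ I^{n+1}M = x₀ I^n M; the proof rests on these three facts.

Koszul side: H_{i+1}(x; M) maps onto H_{i+1}(tail; M / x₀M), and the kernel consists of the classes
of e₀ ∧ w with entries of w in A. For x of length r + 1 this contributes binom(r, i) λ(A)
(`IsDSequence.length_koszulHomology_succ`).

Graded side: monomials of degree n give a surjection (M/IM)^{N(n)} → I^nM / I^{n+1}M; let κ(n) be
the length of its kernel. On gr_I(M), multiplication by x₀ is injective in positive degrees and has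
kernel isomorphic to A in degree 0, so κ(n+1) = κ(n) + κ'(n+1) + [n = 0] λ(A), where κ' belongs to M
/ x₀M (`IsDSequence.hasPresentation_succ`). For generating series, (1 - t) K = K' + λ(A) t; the
Koszul recursion then yields (1 - t)^r K = ∑_{i<r} (-1)^i h_{i+1} t^{i+1} for x of length r.

Kernels of finite length leave the sequence exact under H⁰_𝔪, so λ(H_n) = N(n) h₀ - κ(n), where N
has series (1 - t)^{-r}. This is the Hilbert series; expanding its numerator in powers of 1 - t
gives the 𝐣-coefficients.

For regularity: the 𝐣-coefficients of index ≥ 1 depend on h₁, …, h_r by a triangular system with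
diagonal ±1, so they vanish together. By the Koszul recursion h₁ = 0 says that every successive
annihilator A vanishes, which is weak regularity, and it forces all h_i = 0 for i > 0. -/

namespace JTransform

noncomputable section

open scoped Pointwise

/-! ### Lengths of subquotients -/

section SubLength

variable {R : Type*} [CommRing R] {X Y : Type*} [AddCommGroup X] [Module R X]
  [AddCommGroup Y] [Module R Y]

/-- The length of the subquotient `P / P ∩ Q`. -/
def subLength (P Q : Submodule R X) : ℕ∞ := Module.length R (P ⧸ Q.submoduleOf P)

lemma length_quotient_comap (f : X →ₗ[R] Y) {P Q : Submodule R Y} (hP : ∀ x, f x ∈ P)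
    (hs : ∀ y ∈ P, ∃ x, y - f x ∈ Q) : Module.length R (X ⧸ Q.comap f) = subLength P Q := by
  let g : X →ₗ[R] P ⧸ Q.submoduleOf P := (Q.submoduleOf P).mkQ ∘ₗ f.codRestrict P hP
  have hg : LinearMap.ker g = Q.comap f := by
    ext x
    exact Submodule.Quotient.mk_eq_zero _
  have hgs : Function.Surjective g := by
    intro y
    obtain ⟨⟨y, hy⟩, rfl⟩ := Submodule.mkQ_surjective _ y
    obtain ⟨x, hx⟩ := hs y hy
    refine ⟨x, ?_⟩
    simp only [g, LinearMap.comp_apply, Submodule.mkQ_apply]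
    rw [eq_comm, Submodule.Quotient.eq]
    exact hx
  rw [← hg]
  exact (g.quotKerEquivOfSurjective hgs).length_eq

lemma subLength_add_of_le {P N Q : Submodule R X} (hQN : Q ≤ N) (hNP : N ≤ P) :
    subLength P Q = subLength N Q + subLength P N := by
  let f : N ⧸ Q.submoduleOf N →ₗ[R] P ⧸ Q.submoduleOf P :=
    Submodule.mapQ _ _ (Submodule.inclusion hNP) fun x hx => hx
  let g : P ⧸ Q.submoduleOf P →ₗ[R] P ⧸ N.submoduleOf P :=
    Submodule.mapQ _ _ LinearMap.id fun x hx => hQN hx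
  refine Module.length_eq_add_of_exact f g ?_ ?_ ?_
  · rw [← LinearMap.ker_eq_bot, Submodule.eq_bot_iff]
    intro z hz
    obtain ⟨z, rfl⟩ := Submodule.mkQ_surjective _ z
    have hz := (Submodule.Quotient.mk_eq_zero (Q.submoduleOf P)).1 hz
    exact (Submodule.Quotient.mk_eq_zero _).2 hz
  · intro z
    obtain ⟨z, rfl⟩ := Submodule.mkQ_surjective _ z
    exact ⟨Submodule.Quotient.mk z, rfl⟩
  · intro z
    obtain ⟨z, rfl⟩ := Submodule.mkQ_surjective _ z
    constructor
    · intro hz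
      have hz := (Submodule.Quotient.mk_eq_zero (N.submoduleOf P)).1 hz
      exact ⟨Submodule.Quotient.mk ⟨z, hz⟩, rfl⟩
    · rintro ⟨n, hn⟩
      obtain ⟨n, rfl⟩ := Submodule.mkQ_surjective _ n
      have hn : (n : X) - z ∈ Q := (Submodule.Quotient.eq (Q.submoduleOf P)).1 hn
      refine (Submodule.Quotient.mk_eq_zero (N.submoduleOf P)).2 ?_
      change (z : X) ∈ N
      rw [← sub_sub_self (n : X) z]
      exact Submodule.sub_mem _ n.2 (hQN hn)

lemma subLength_self (P : Submodule R X) : subLength P P = 0 := by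
  rw [subLength, Submodule.submoduleOf_self]
  exact Module.length_eq_zero

lemma subLength_bot (P : Submodule R X) : subLength P ⊥ = Module.length R P := by
  have h : (⊥ : Submodule R X).submoduleOf P = ⊥ := by
    ext; simp [Submodule.submoduleOf]
  exact ((Submodule.quotEquivOfEq _ _ h).trans (Submodule.quotEquivOfEqBot _ rfl)).length_eq

/-- Additivity of the length along `P / Q → P' / Q'`. -/
lemma subLength_eq_add_of_map (f : X →ₗ[R] Y) {P Q : Submodule R X} {P' Q' : Submodule R Y}
    (hQP : Q ≤ P) (hP : ∀ x ∈ P, f x ∈ P') (hQ : ∀ x ∈ Q, f x ∈ Q')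
    (hs : ∀ y ∈ P', ∃ x ∈ P, y - f x ∈ Q') :
    subLength P Q = subLength (P ⊓ Q'.comap f) Q + subLength P' Q' := by
  -- In the chain Q ≤ P ⊓ f⁻¹Q' ≤ P the lower layer is the kernel of P/Q → P'/Q' and the upper layer
  -- its image, which is everything by `hs`.
  rw [subLength_add_of_le (le_inf hQP (show Q ≤ Q'.comap f from hQ)) inf_le_left]
  congr 1
  rw [← length_quotient_comap (f ∘ₗ P.subtype) (P := P') (Q := Q') (fun x => hP x x.2)
    (fun y hy => by
      obtain ⟨x, hx, h⟩ := hs y hy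
      exact ⟨⟨x, hx⟩, h⟩), subLength]
  have : (P ⊓ Q'.comap f).submoduleOf P = Q'.comap (f ∘ₗ P.subtype) := by
    ext; simp [Submodule.submoduleOf]
  rw [this]

lemma subLength_eq_of_map (f : X →ₗ[R] Y) {P Q : Submodule R X} {P' Q' : Submodule R Y}
    (hQP : Q ≤ P) (hP : ∀ x ∈ P, f x ∈ P') (hQ : ∀ x ∈ P, f x ∈ Q' ↔ x ∈ Q)
    (hs : ∀ y ∈ P', ∃ x ∈ P, y - f x ∈ Q') : subLength P Q = subLength P' Q' := by
  rw [subLength_eq_add_of_map f hQP hP (fun x hx => (hQ x (hQP hx)).2 hx) hs]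
  have : P ⊓ Q'.comap f = Q :=
    le_antisymm (fun x hx => (hQ x hx.1).1 hx.2) fun x hx => ⟨hQP hx, (hQ x (hQP hx)).2 hx⟩
  rw [this, subLength_self, zero_add]

lemma subLength_pi {ι : Type*} [Fintype ι] {P Q : Submodule R X} :
    subLength (Submodule.pi Set.univ fun _ : ι => P) (Submodule.pi Set.univ fun _ : ι => Q) =
      Fintype.card ι * subLength P Q := by
  classical
  let f : (ι → P) →ₗ[R] (ι → X) := LinearMap.pi fun i => P.subtype ∘ₗ LinearMap.proj i
  rw [← length_quotient_comap f (fun x => by simp [f]) (fun y hy => ?_)]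
  · have : (Submodule.pi Set.univ fun _ : ι => Q).comap f =
        Submodule.pi Set.univ fun _ : ι => Q.submoduleOf P := by
      ext; simp [f, Submodule.submoduleOf]
    rw [this, (Submodule.quotientPi _).length_eq, Module.length_pi, ENat.card_eq_coe_fintype_card,
      subLength]
  · refine ⟨fun i => ⟨y i, hy i trivial⟩, ?_⟩
    convert Submodule.zero_mem _
    ext i
    simp [f]

end SubLength

/-! ### 𝔪-power torsion and finite length -/

section Torsion

open IsLocalRing

variable {R : Type*} [CommRing R] [IsLocalRing R] {X Y : Type*} [AddCommGroup X] [Module R X]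
  [AddCommGroup Y] [Module R Y]

/-- The saturation `N :_X 𝔪^∞`. -/
def saturation (N : Submodule R X) : Submodule R X := (localH0 R (X ⧸ N)).comap N.mkQ

lemma mem_saturation {N : Submodule R X} {x : X} :
    x ∈ saturation N ↔ ∃ l : ℕ, ∀ a ∈ maximalIdeal R ^ l, a • x ∈ N := by
  refine exists_congr fun l => forall₂_congr fun a _ => ?_
  rw [← map_smul, Submodule.mkQ_apply, Submodule.Quotient.mk_eq_zero]

lemma le_saturation (N : Submodule R X) : N ≤ saturation N := fun _ hx =>
  mem_saturation.2 ⟨0, fun a _ => N.smul_mem a hx⟩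

/-- Torsion of a quotient is computed by a saturation inside the ambient module; this makes H⁰_𝔪
accessible to the calculus of `subLength`. -/
lemma length_localH0_subquotient (P Q : Submodule R X) :
    Module.length R (localH0 R (P ⧸ Q.submoduleOf P)) = subLength (saturation Q ⊓ P) Q := by
  let f : ↥(saturation Q ⊓ P) →ₗ[R] P ⧸ Q.submoduleOf P :=
    (Q.submoduleOf P).mkQ ∘ₗ Submodule.inclusion inf_le_right
  rw [← subLength_bot, ← length_quotient_comap f]
  · have : (⊥ : Submodule R (P ⧸ Q.submoduleOf P)).comap f =
        Q.submoduleOf (saturation Q ⊓ P) := by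
      ext
      exact Submodule.Quotient.mk_eq_zero _
    rw [this, subLength]
  · rintro ⟨x, hx, hxP⟩
    obtain ⟨l, hl⟩ := mem_saturation.1 hx
    refine ⟨l, fun a ha => ?_⟩
    rw [← map_smul]
    simp only [f, LinearMap.comp_apply, Submodule.mkQ_apply, Submodule.Quotient.mk_eq_zero]
    exact hl a ha
  · rintro y ⟨l, hl⟩
    obtain ⟨y, rfl⟩ := Submodule.mkQ_surjective _ y
    refine ⟨⟨y, mem_saturation.2 ⟨l, fun a ha => ?_⟩, y.2⟩, ?_⟩
    · have := hl a ha
      rw [← map_smul, Submodule.mkQ_apply, Submodule.Quotient.mk_eq_zero] at this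
      exact this
    · exact (Submodule.mem_bot R).2 (sub_self _)

/-- A simple module over a local ring is killed by 𝔪, so each composition factor costs one power of
𝔪. -/
lemma _root_.IsFiniteLength.exists_pow_smul_eq_zero {N : Type*} [AddCommGroup N] [Module R N]
    (h : IsFiniteLength R N) : ∃ l : ℕ, ∀ a ∈ maximalIdeal R ^ l, ∀ z : N, a • z = 0 := by
  induction h with
  | of_subsingleton => exact ⟨0, fun _ _ _ => Subsingleton.elim _ _⟩
  | @of_simple_quotient M _ _ N _ _ ih =>
    obtain ⟨l, hl⟩ := ih
    have hm : ∀ a ∈ maximalIdeal R, ∀ z : M, a • z ∈ N := by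
      intro a ha z
      have := IsSimpleModule.annihilator_isMaximal (R := R) (M := M ⧸ N)
      rw [← IsLocalRing.eq_maximalIdeal this] at ha
      have := Module.mem_annihilator.1 ha (Submodule.Quotient.mk z)
      rwa [← Submodule.Quotient.mk_smul, Submodule.Quotient.mk_eq_zero] at this
    refine ⟨l + 1, fun a ha z => ?_⟩
    rw [pow_succ] at ha
    refine Submodule.mul_induction_on ha (fun b hb c hc => ?_) fun b c hb hc => ?_
    · rw [mul_smul]
      exact congrArg Subtype.val (hl b hb ⟨c • z, hm c hc z⟩)
    · rw [add_smul, hb, hc, add_zero]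

lemma exists_pow_smul_mem_of_subLength_ne_top {P Q : Submodule R X} (h : subLength P Q ≠ ⊤) :
    ∃ l : ℕ, ∀ a ∈ maximalIdeal R ^ l, ∀ x ∈ P, a • x ∈ Q := by
  obtain ⟨l, hl⟩ := (Module.length_ne_top_iff.1 h).exists_pow_smul_eq_zero
  refine ⟨l, fun a ha x hx => ?_⟩
  have := hl a ha (Submodule.Quotient.mk ⟨x, hx⟩)
  rw [← Submodule.Quotient.mk_smul, Submodule.Quotient.mk_eq_zero] at this
  exact this

/-- In the inductive step 𝔪^l X is finitely generated and killed by 𝔪, hence a finite-dimensional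
space over the residue field, while X / 𝔪^l X is covered by the induction hypothesis. -/
lemma isFiniteLength_of_pow_smul_eq_zero [IsNoetherianRing R] [Module.Finite R X] (l : ℕ)
    (h : ∀ a ∈ maximalIdeal R ^ l, ∀ x : X, a • x = 0) : IsFiniteLength R X := by
  induction l generalizing X with
  | zero =>
    have : Subsingleton X := ⟨fun x y => by
      rw [← one_smul R x, ← one_smul R y, h 1 (by simp), h 1 (by simp)]⟩
    exact .of_subsingleton
  | succ l ih =>
    have h1 : IsFiniteLength R ↥(maximalIdeal R ^ l • ⊤ : Submodule R X) := by
      have hk : ∀ a ∈ maximalIdeal R, ∀ z : ↥(maximalIdeal R ^ l • ⊤ : Submodule R X),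
          a • z = 0 := by
        rintro a ha ⟨z, hz⟩
        ext
        change a • z = 0
        refine Submodule.smul_induction_on hz (fun b hb x _ => ?_) fun x y hx hy => ?_
        · rw [smul_smul]
          exact h _ (by rw [pow_succ']; exact Ideal.mul_mem_mul ha hb) x
        · rw [smul_add, hx, hy, add_zero]
      let _ : Module (ResidueField R) ↥(maximalIdeal R ^ l • ⊤ : Submodule R X) :=
        Module.IsTorsionBySet.module (I := maximalIdeal R) fun z a => hk a a.2 z
      have : IsScalarTower R (ResidueField R) ↥(maximalIdeal R ^ l • ⊤ : Submodule R X) :=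
        ⟨fun a b z => by
          obtain ⟨b, rfl⟩ := IsLocalRing.residue_surjective b
          rw [← IsLocalRing.ResidueField.algebraMap_eq, Algebra.smul_def, ← map_mul]
          exact mul_smul a b z⟩
      have : Module.Finite (ResidueField R) ↥(maximalIdeal R ^ l • ⊤ : Submodule R X) :=
        Module.Finite.of_restrictScalars_finite R _ _
      rw [← Module.length_ne_top_iff, Module.length_eq_of_surjective (S := R) (R := ResidueField R)
        residue_surjective]
      exact Module.length_ne_top
    have h2 : IsFiniteLength R (X ⧸ (maximalIdeal R ^ l • ⊤ : Submodule R X)) := by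
      refine ih fun a ha x => ?_
      obtain ⟨x, rfl⟩ := Submodule.mkQ_surjective _ x
      rw [← map_smul, Submodule.mkQ_apply, Submodule.Quotient.mk_eq_zero]
      exact Submodule.smul_mem_smul ha trivial
    rw [← Module.length_ne_top_iff] at h1 h2 ⊢
    rw [Module.length_eq_add_of_exact (maximalIdeal R ^ l • ⊤ : Submodule R X).subtype
      (maximalIdeal R ^ l • ⊤ : Submodule R X).mkQ (Submodule.subtype_injective _)
      (Submodule.mkQ_surjective _) (LinearMap.exact_subtype_mkQ _)]
    exact WithTop.add_ne_top.2 ⟨h1, h2⟩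

/-- The torsion submodule is finitely generated, so a single power of 𝔪 kills it. -/
lemma isFiniteLength_localH0 [IsNoetherianRing R] [Module.Finite R X] :
    IsFiniteLength R (localH0 R X) := by
  have hl : ∀ S : Submodule R X, S.FG → S ≤ localH0 R X →
      ∃ l, ∀ a ∈ maximalIdeal R ^ l, ∀ x ∈ S, a • x = 0 := by
    intro S hS
    induction S, hS using Submodule.fg_induction with
    | singleton x =>
      intro h
      obtain ⟨l, hl⟩ := h (Submodule.mem_span_singleton_self x)
      refine ⟨l, fun a ha y hy => ?_⟩
      obtain ⟨c, rfl⟩ := Submodule.mem_span_singleton.1 hy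
      rw [smul_comm, hl a ha, smul_zero]
    | sup S T _ _ hS hT =>
      intro h
      obtain ⟨k, hk⟩ := hS (le_sup_left.trans h)
      obtain ⟨l, hl⟩ := hT (le_sup_right.trans h)
      refine ⟨max k l, fun a ha x hx => ?_⟩
      obtain ⟨y, hy, z, hz, rfl⟩ := Submodule.mem_sup.1 hx
      rw [smul_add, hk a (Ideal.pow_le_pow_right (le_max_left k l) ha) y hy,
        hl a (Ideal.pow_le_pow_right (le_max_right k l) ha) z hz, add_zero]
  obtain ⟨l, hl⟩ := hl (localH0 R X) (IsNoetherian.noetherian _) le_rfl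
  exact isFiniteLength_of_pow_smul_eq_zero l fun a ha x => Subtype.ext (hl a ha x x.2)

end Torsion

/-! ### Colon and intersection properties of d-sequences -/

section DSequence

variable {R : Type*} [CommRing R] {M : Type*} [AddCommGroup M] [Module R M]

lemma mk_mem_smul_top_iff {K : Ideal R} {a : R} {m : M} :
    (Submodule.Quotient.mk m : QuotSMulTop a M) ∈ (K • ⊤ : Submodule R (QuotSMulTop a M)) ↔
      m ∈ ((K ⊔ Ideal.span {a}) • ⊤ : Submodule R M) := by
  have h : (K • ⊤ : Submodule R (QuotSMulTop a M)) =
      (K • ⊤ : Submodule R M).map (a • ⊤ : Submodule R M).mkQ := by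
    rw [Submodule.map_smul'', Submodule.map_top, Submodule.range_mkQ]
  rw [h, ← Submodule.mkQ_apply, ← Submodule.mem_comap, Submodule.comap_map_mkQ, Submodule.sup_smul,
    Submodule.ideal_span_singleton_smul, sup_comm]

lemma mem_sup_span_smul_iff {K : Ideal R} {a : R} {N : Submodule R M} {m : M} :
    m ∈ (K ⊔ Ideal.span {a}) • N ↔ ∃ u ∈ K • N, ∃ y ∈ N, u + a • y = m := by
  rw [Submodule.sup_smul, Submodule.ideal_span_singleton_smul, Submodule.mem_sup]
  simp [Submodule.mem_smul_pointwise_iff_exists]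

lemma sup_pow_le (K L : Ideal R) (n : ℕ) : (K ⊔ L) ^ n ≤ K ^ n ⊔ L := by
  induction n with
  | zero => simp
  | succ n ih =>
    have h : (K ^ n ⊔ L) * (K ⊔ L) = K ^ n * K ⊔ L * K ⊔ (K ^ n * L ⊔ L * L) := by
      rw [Ideal.mul_sup, Ideal.sup_mul, Ideal.sup_mul]
    rw [pow_succ, pow_succ]
    refine (Ideal.mul_mono ih le_rfl).trans (h.le.trans ?_)
    exact sup_le (sup_le le_sup_left (le_sup_of_le_right Ideal.mul_le_left))
      (sup_le (le_sup_of_le_right Ideal.mul_le_right) (le_sup_of_le_right Ideal.mul_le_left))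

/-- The ideal generated by the first `k` elements of the sequence `x`. -/
def initialIdeal {r : ℕ} (x : Fin r → R) (k : ℕ) : Ideal R :=
  Ideal.span (x '' {i | (i : ℕ) < k})

lemma initialIdeal_zero {r : ℕ} (x : Fin r → R) : initialIdeal x 0 = ⊥ := by
  simp [initialIdeal]

lemma initialIdeal_succ {r : ℕ} (x : Fin r → R) (k : Fin r) :
    initialIdeal x (k + 1) = initialIdeal x k ⊔ Ideal.span {x k} := by
  have : {i : Fin r | (i : ℕ) < k + 1} = insert k {i : Fin r | (i : ℕ) < k} := by
    ext i
    simp only [Set.mem_ofPred_eq, Set.mem_insert_iff, Fin.ext_iff]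
    omega
  rw [initialIdeal, this, Set.image_insert_eq, Ideal.span_insert, sup_comm, initialIdeal]

lemma initialIdeal_eq_span_range {r : ℕ} (x : Fin r → R) :
    initialIdeal x r = Ideal.span (Set.range x) := by
  simp [initialIdeal]

lemma initialIdeal_mono {r : ℕ} (x : Fin r → R) {k l : ℕ} (h : k ≤ l) :
    initialIdeal x k ≤ initialIdeal x l :=
  Ideal.span_mono (Set.image_mono fun _ hi => lt_of_lt_of_le hi h)

lemma initialIdeal_tail {r : ℕ} (x : Fin (r + 1) → R) (k : ℕ) :
    initialIdeal (Fin.tail x) k ⊔ Ideal.span {x 0} = initialIdeal x (k + 1) := by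
  rw [initialIdeal, initialIdeal, ← Ideal.span_union]
  congr 1
  ext a
  simp only [Set.mem_union, Set.mem_image, Set.mem_ofPred_eq, Set.mem_singleton_iff, Fin.tail]
  constructor
  · rintro (⟨i, hi, rfl⟩ | rfl)
    · exact ⟨i.succ, by simpa using hi, rfl⟩
    · exact ⟨0, by simp, rfl⟩
  · rintro ⟨i, hi, rfl⟩
    rcases Fin.eq_zero_or_eq_succ i with rfl | ⟨j, rfl⟩
    · exact Or.inr rfl
    · exact Or.inl ⟨j, by simpa using hi, rfl⟩

lemma span_range_tail {r : ℕ} (x : Fin (r + 1) → R) :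
    Ideal.span (Set.range (Fin.tail x)) ⊔ Ideal.span {x 0} = Ideal.span (Set.range x) := by
  rw [← initialIdeal_eq_span_range, ← initialIdeal_eq_span_range, initialIdeal_tail]

variable {r : ℕ}

/-- Colons over M / x₀M by initial ideals of the tail are colons over M by initial ideals of x that
are one longer. -/
lemma IsDSequence.tail {x : Fin (r + 1) → R} (hs : IsDSequence x M) :
    IsDSequence (Fin.tail x) (QuotSMulTop (x 0) M) := by
  intro i j hij m
  obtain ⟨m, rfl⟩ := Submodule.mkQ_surjective _ m
  have h := hs i.succ j.succ (Fin.succ_le_succ_iff.2 hij) m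
  change _ ∈ initialIdeal x (i.succ : ℕ) • (⊤ : Submodule R M) ↔
    _ ∈ initialIdeal x (i.succ : ℕ) • (⊤ : Submodule R M) at h
  rw [Fin.val_succ, ← initialIdeal_tail] at h
  rw [← map_smul, ← map_smul, Submodule.mkQ_apply, Submodule.mkQ_apply, mk_mem_smul_top_iff,
    mk_mem_smul_top_iff]
  exact h

variable {x : Fin r → R}

lemma IsDSequence.smul_mem (hs : IsDSequence x M) {i j : Fin r} (hij : i ≤ j) {m : M}
    (hm : x i • m ∈ (initialIdeal x i • ⊤ : Submodule R M)) :
    x j • m ∈ (initialIdeal x i • ⊤ : Submodule R M) := by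
  refine (hs i j hij m).1 ?_
  rw [mul_comm, mul_smul]
  exact Submodule.smul_mem _ _ hm

/-- Write J_l for the l-th initial ideal. If m = u + x_l y with u ∈ J_l M, then x_l m ∈ J_k M ⊆ J_l
M gives x_l² y ∈ J_l M, hence x_l y ∈ J_l M and m ∈ J_l M. Thus l descends from r to k. -/
lemma IsDSequence.mem_of_smul_mem (hs : IsDSequence x M) {k : ℕ} (hk : k ≤ r) {m : M}
    (hm : ∀ j : Fin r, k ≤ j → x j • m ∈ (initialIdeal x k • ⊤ : Submodule R M))
    (hmI : m ∈ (Ideal.span (Set.range x) • ⊤ : Submodule R M)) :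
    m ∈ (initialIdeal x k • ⊤ : Submodule R M) := by
  rw [← initialIdeal_eq_span_range] at hmI
  have key : ∀ l, k ≤ l → l ≤ r → m ∈ (initialIdeal x l • ⊤ : Submodule R M) →
      m ∈ (initialIdeal x k • ⊤ : Submodule R M) := by
    intro l hl
    induction l, hl using Nat.le_induction with
    | base => exact fun _ h => h
    | succ l hl ih =>
      intro hlr h
      refine ih (by omega) ?_
      let i : Fin r := ⟨l, hlr⟩
      rw [show l + 1 = (i : ℕ) + 1 from rfl, initialIdeal_succ, mem_sup_span_smul_iff] at h
      obtain ⟨u, hu, y, -, rfl⟩ := h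
      have h1 := Submodule.smul_mono_left (N := ⊤) (initialIdeal_mono x hl) (hm i hl)
      refine Submodule.add_mem _ hu ((hs i i le_rfl y).1 ?_)
      rw [smul_add, smul_smul] at h1
      exact (Submodule.add_mem_iff_right _ (Submodule.smul_mem _ _ hu)).1 h1
  exact key r hk le_rfl hmI

/-- Induction upwards on n and downwards on k. With m = u + x_k y supplied by the case k + 1, the
element x_k y lies in J_k M, hence so do all x_j y with j ≥ k. Then y ∈ J_k M by
`IsDSequence.mem_of_smul_mem`, and the case of n and k improves this to y ∈ J_k I^n M. -/
lemma IsDSequence.inf_pow_le (hs : IsDSequence x M) (n : ℕ) {k : ℕ} (hk : k ≤ r) :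
    (initialIdeal x k • ⊤ ⊓ Ideal.span (Set.range x) ^ (n + 1) • ⊤ : Submodule R M) ≤
      initialIdeal x k • (Ideal.span (Set.range x) ^ n • ⊤ : Submodule R M) := by
  induction n generalizing k with
  | zero => simp
  | succ n ihn =>
    induction hk using Nat.decreasingInduction with
    | self =>
      rw [initialIdeal_eq_span_range, ← Submodule.mul_smul, ← pow_succ']
      exact inf_le_right
    | of_succ k hk ih =>
      rintro m ⟨hm, hmI⟩
      let i : Fin r := ⟨k, hk⟩
      have h := ih ⟨Submodule.smul_mono_left (initialIdeal_mono x k.le_succ) hm, hmI⟩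
      rw [show k + 1 = (i : ℕ) + 1 from rfl, initialIdeal_succ, mem_sup_span_smul_iff] at h
      obtain ⟨u, hu, y, hy, rfl⟩ := h
      refine Submodule.add_mem _ hu ?_
      have hxy : x i • y ∈ (initialIdeal x i • ⊤ : Submodule R M) :=
        (Submodule.add_mem_iff_right _ (Submodule.smul_mono le_rfl le_top hu)).1 hm
      have hyI : y ∈ (Ideal.span (Set.range x) • ⊤ : Submodule R M) :=
        Submodule.smul_mono_left (Ideal.pow_le_self n.succ_ne_zero) hy
      have hy' := ihn hk.le ⟨hs.mem_of_smul_mem hk.le (fun j hj => hs.smul_mem (i := i) hj hxy) hyI,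
        hy⟩
      rw [pow_succ', ← Submodule.mul_smul, mul_left_comm, Submodule.mul_smul, Submodule.mul_smul]
      exact Submodule.smul_mem_smul (Ideal.subset_span ⟨i, rfl⟩) hy'

variable {x : Fin (r + 1) → R}

lemma IsDSequence.smul_eq_zero (hs : IsDSequence x M) (j : Fin (r + 1)) {m : M}
    (hm : x 0 • m = 0) : x j • m = 0 := by
  have h := hs.smul_mem (Fin.zero_le j) (m := m) (by rw [hm]; exact Submodule.zero_mem _)
  rw [Fin.val_zero, initialIdeal_zero, Submodule.bot_smul] at h
  exact h

/-- The case k = 0 of `IsDSequence.mem_of_smul_mem`: every x_j kills 0 :_M x₀. -/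
lemma IsDSequence.eq_zero_of_mem (hs : IsDSequence x M) {m : M}
    (hm : x 0 • m = 0) (hmI : m ∈ (Ideal.span (Set.range x) • ⊤ : Submodule R M)) : m = 0 := by
  have h := hs.mem_of_smul_mem (Nat.zero_le _)
    (fun j _ => by rw [hs.smul_eq_zero j hm]; exact Submodule.zero_mem _) hmI
  rw [initialIdeal_zero, Submodule.bot_smul] at h
  exact h

/-- The case k = 1 of `IsDSequence.inf_pow_le`, that is, x₀M ∩ I^{n+1}M = x₀ I^n M. -/
lemma IsDSequence.exists_of_smul_mem_pow (hs : IsDSequence x M) {n : ℕ} {m : M}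
    (hm : x 0 • m ∈ (Ideal.span (Set.range x) ^ (n + 1) • ⊤ : Submodule R M)) :
    ∃ m' ∈ (Ideal.span (Set.range x) ^ n • ⊤ : Submodule R M), x 0 • m' = x 0 • m := by
  have h1 : initialIdeal x 1 = Ideal.span {x 0} := by
    have := initialIdeal_succ x 0
    rwa [Fin.val_zero, initialIdeal_zero, bot_sup_eq] at this
  have h := hs.inf_pow_le n (k := 1) (by omega) ⟨?_, hm⟩
  · rw [h1, Submodule.ideal_span_singleton_smul,
      Submodule.mem_smul_pointwise_iff_exists] at h
    exact h
  · rw [h1]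
    exact Submodule.smul_mem_smul (Ideal.mem_span_singleton_self _) trivial

end DSequence

/-! ### Koszul homology modulo the first element -/

section Koszul

variable {R : Type*} [CommRing R] {M : Type*} [AddCommGroup M] [Module R M]

/-- An index set not containing `0`. -/
def lowIdx {r i : ℕ} (T : {S : Finset (Fin r) // S.card = i}) :
    {S : Finset (Fin (r + 1)) // S.card = i} :=
  ⟨T.1.map (Fin.succEmb r), by rw [Finset.card_map, T.2]⟩

/-- An index set containing `0`. -/
def highIdx {r i : ℕ} (T : {S : Finset (Fin r) // S.card = i}) :
    {S : Finset (Fin (r + 1)) // S.card = i + 1} :=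
  insertIdx (lowIdx T) ⟨0, by simp [lowIdx]⟩

lemma koszulD_apply {r : ℕ} (x : Fin r → R) (i : ℕ) (f : KoszulChain r M (i + 1))
    (T : {S : Finset (Fin r) // S.card = i}) :
    koszulD x M i f T = ∑ j : Fin r, if h : j ∉ T.1 then
      (-1 : R) ^ (T.1.filter (· < j)).card • x j • f (insertIdx T ⟨j, h⟩) else 0 := by
  let g : Fin r → M := fun j => if h : j ∉ T.1 then
    (-1 : R) ^ (T.1.filter (· < j)).card • x j • f (insertIdx T ⟨j, h⟩) else 0
  have h1 : koszulD x M i f T = ∑ j : {j : Fin r // j ∉ T.1}, g j.1 := by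
    simp only [g, koszulD, LinearMap.coe_mk, AddHom.coe_mk]
    exact Finset.sum_congr rfl fun j _ => by rw [dif_pos j.2]
  rw [h1, ← Finset.sum_subtype (Finset.univ.filter (· ∉ T.1)) (by simp) g]
  refine Finset.sum_subset (Finset.filter_subset _ _) fun j _ hj => dif_neg ?_
  simpa using hj

lemma succ_mem_lowIdx {r i : ℕ} {T : {S : Finset (Fin r) // S.card = i}} {j : Fin r} :
    j.succ ∈ (lowIdx T).1 ↔ j ∈ T.1 := by
  simp [lowIdx]

lemma succ_mem_highIdx {r i : ℕ} {T : {S : Finset (Fin r) // S.card = i}} {j : Fin r} :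
    j.succ ∈ (highIdx T).1 ↔ j ∈ T.1 := by
  rw [← succ_mem_lowIdx (T := T)]
  simp only [highIdx, insertIdx, Finset.mem_insert, Fin.succ_ne_zero, false_or]

lemma zero_notMem_lowIdx {r i : ℕ} (T : {S : Finset (Fin r) // S.card = i}) :
    (0 : Fin (r + 1)) ∉ (lowIdx T).1 := by
  simp [lowIdx]

lemma zero_mem_highIdx {r i : ℕ} (T : {S : Finset (Fin r) // S.card = i}) :
    (0 : Fin (r + 1)) ∈ (highIdx T).1 := by
  simp [highIdx, insertIdx]

lemma card_filter_lowIdx {r i : ℕ} (T : {S : Finset (Fin r) // S.card = i}) (j : Fin r) :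
    ((lowIdx T).1.filter (· < j.succ)).card = (T.1.filter (· < j)).card := by
  rw [lowIdx, Finset.filter_map, Finset.card_map]
  congr 1
  ext k
  rw [Finset.mem_filter, Finset.mem_filter]
  exact and_congr_right fun _ => Fin.succ_lt_succ_iff

/-- No index precedes 0, so inserting it carries the sign +1. Together with `koszulD_highIdx` this
exhibits the Koszul complex as the mapping cone of x₀ on the complex of the tail. -/
lemma koszulD_lowIdx {r : ℕ} (x : Fin (r + 1) → R) (i : ℕ) (f : KoszulChain (r + 1) M (i + 1))
    (T : {S : Finset (Fin r) // S.card = i}) :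
    koszulD x M i f (lowIdx T) =
      koszulD (Fin.tail x) M i (fun S => f (lowIdx S)) T + x 0 • f (highIdx T) := by
  rw [koszulD_apply, koszulD_apply, Fin.sum_univ_succ, add_comm]
  congr 1
  · refine Finset.sum_congr rfl fun j _ => ?_
    by_cases h : j ∈ T.1
    · rw [dif_neg (not_not.2 h), dif_neg (not_not.2 (succ_mem_lowIdx.2 h))]
    · rw [dif_pos h, dif_pos (mt succ_mem_lowIdx.1 h)]
      have e2 : insertIdx (lowIdx T) ⟨j.succ, mt succ_mem_lowIdx.1 h⟩ =
          lowIdx (insertIdx T ⟨j, h⟩) := by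
        apply Subtype.ext
        simp [insertIdx, lowIdx, Finset.map_insert]
      rw [card_filter_lowIdx, e2]
      rfl
  · rw [dif_pos (by simp [lowIdx])]
    simp [highIdx]

/-- The index 0 precedes every inserted index and so flips each sign. -/
lemma koszulD_highIdx {r : ℕ} (x : Fin (r + 1) → R) (i : ℕ)
    (f : KoszulChain (r + 1) M (i + 1 + 1)) (T : {S : Finset (Fin r) // S.card = i}) :
    koszulD x M (i + 1) f (highIdx T) =
      -koszulD (Fin.tail x) M i (fun S => f (highIdx S)) T := by
  rw [koszulD_apply, koszulD_apply, Fin.sum_univ_succ, dif_neg (not_not.2 (zero_mem_highIdx T)),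
    zero_add, ← Finset.sum_neg_distrib]
  refine Finset.sum_congr rfl fun j _ => ?_
  by_cases h : j ∈ T.1
  · rw [dif_neg (not_not.2 h), dif_neg (not_not.2 (succ_mem_highIdx.2 h)), neg_zero]
  · rw [dif_pos h, dif_pos (mt succ_mem_highIdx.1 h)]
    have e1 : ((highIdx T).1.filter (· < j.succ)).card = (T.1.filter (· < j)).card + 1 := by
      rw [← card_filter_lowIdx T j]
      exact (koszul_sign _ 0 j.succ (zero_notMem_lowIdx T) (Fin.succ_pos j)).1
    have e2 : insertIdx (highIdx T) ⟨j.succ, mt succ_mem_highIdx.1 h⟩ =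
        highIdx (insertIdx T ⟨j, h⟩) := by
      apply Subtype.ext
      simp only [insertIdx, highIdx, lowIdx, Finset.map_insert]
      exact Finset.insert_comm _ _ _
    rw [e1, e2, pow_succ]
    simp [Fin.tail]

lemma exists_eq_lowIdx {r i : ℕ} (S : {S : Finset (Fin (r + 1)) // S.card = i})
    (h : (0 : Fin (r + 1)) ∉ S.1) : ∃ T, lowIdx T = S := by
  obtain ⟨S, hi⟩ := S
  have hS : (S.preimage Fin.succ (Fin.succ_injective r).injOn).map (Fin.succEmb r) = S := by
    ext k
    rcases Fin.eq_zero_or_eq_succ k with rfl | ⟨j, rfl⟩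
    · simpa using h
    · simp
  exact ⟨⟨_, (Finset.card_map _).symm.trans ((congrArg Finset.card hS).trans hi)⟩, Subtype.ext hS⟩

lemma exists_eq_highIdx {r i : ℕ} (S : {S : Finset (Fin (r + 1)) // S.card = i + 1})
    (h : (0 : Fin (r + 1)) ∈ S.1) : ∃ T, highIdx T = S := by
  obtain ⟨T, hT⟩ := exists_eq_lowIdx ⟨S.1.erase 0, (Finset.card_erase_of_mem h).trans
    (by rw [S.2, Nat.add_sub_cancel])⟩ (by simp)
  refine ⟨T, Subtype.ext ?_⟩
  simp only [highIdx, insertIdx, hT]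
  exact Finset.insert_erase h

lemma lowIdx_injective {r i : ℕ} : Function.Injective (lowIdx (r := r) (i := i)) := by
  intro S T h
  exact Subtype.ext (Finset.map_injective _ (congrArg Subtype.val h))

lemma highIdx_injective {r i : ℕ} : Function.Injective (highIdx (r := r) (i := i)) := by
  intro S T h
  have h := congrArg (fun q => q.1.erase 0) h
  simp only [highIdx, insertIdx] at h
  rw [Finset.erase_insert (zero_notMem_lowIdx S), Finset.erase_insert (zero_notMem_lowIdx T)] at h
  exact lowIdx_injective (Subtype.ext h)

/-- The index sets of size `i + 1` are those avoiding `0` and those containing `0`. -/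
def idxEquiv (r i : ℕ) : {S : Finset (Fin (r + 1)) // S.card = i + 1} ≃
    {S : Finset (Fin r) // S.card = i + 1} ⊕ {S : Finset (Fin r) // S.card = i} :=
  (Equiv.ofBijective (Sum.elim lowIdx highIdx) ⟨by
    refine Function.Injective.sumElim lowIdx_injective highIdx_injective fun S T h => ?_
    exact zero_notMem_lowIdx S (h ▸ zero_mem_highIdx T), fun S => by
    by_cases h : (0 : Fin (r + 1)) ∈ S.1
    · obtain ⟨T, hT⟩ := exists_eq_highIdx S h
      exact ⟨Sum.inr T, hT⟩
    · obtain ⟨T, hT⟩ := exists_eq_lowIdx S h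
      exact ⟨Sum.inl T, hT⟩⟩).symm

lemma idxEquiv_lowIdx {r i : ℕ} (T : {S : Finset (Fin r) // S.card = i + 1}) :
    idxEquiv r i (lowIdx T) = Sum.inl T :=
  (Equiv.symm_apply_eq _).2 rfl

lemma idxEquiv_highIdx {r i : ℕ} (T : {S : Finset (Fin r) // S.card = i}) :
    idxEquiv r i (highIdx T) = Sum.inr T :=
  (Equiv.symm_apply_eq _).2 rfl

/-- The chain `v + e₀ ∧ u`. -/
def joinChain {r i : ℕ} (v : KoszulChain r M (i + 1)) (u : KoszulChain r M i) :
    KoszulChain (r + 1) M (i + 1) := fun S => Sum.elim v u (idxEquiv r i S)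

@[simp] lemma joinChain_lowIdx {N : Type*} {r i : ℕ} (v : KoszulChain r N (i + 1))
    (u : KoszulChain r N i)
    (T : {S : Finset (Fin r) // S.card = i + 1}) : joinChain v u (lowIdx T) = v T := by
  rw [joinChain, idxEquiv_lowIdx, Sum.elim_inl]

@[simp] lemma joinChain_highIdx {N : Type*} {r i : ℕ} (v : KoszulChain r N (i + 1))
    (u : KoszulChain r N i)
    (T : {S : Finset (Fin r) // S.card = i}) : joinChain v u (highIdx T) = u T := by
  rw [joinChain, idxEquiv_highIdx, Sum.elim_inr]

lemma koszulChain_ext {N : Type*} {r i : ℕ} {f g : KoszulChain (r + 1) N (i + 1)}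
    (hl : ∀ T, f (lowIdx T) = g (lowIdx T)) (hh : ∀ T, f (highIdx T) = g (highIdx T)) :
    f = g := by
  funext S
  by_cases h : (0 : Fin (r + 1)) ∈ S.1
  · obtain ⟨T, rfl⟩ := exists_eq_highIdx S h
    exact hh T
  · obtain ⟨T, rfl⟩ := exists_eq_lowIdx S h
    exact hl T

lemma koszulChain_zero_ext {N : Type*} {r : ℕ} {f g : KoszulChain (r + 1) N 0}
    (hl : ∀ T, f (lowIdx T) = g (lowIdx T)) : f = g := by
  funext S
  have h : (0 : Fin (r + 1)) ∉ S.1 := by simp [Finset.card_eq_zero.1 S.2]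
  obtain ⟨T, rfl⟩ := exists_eq_lowIdx S h
  exact hl T

lemma koszulD_mem {r : ℕ} (x : Fin r → R) (i : ℕ) (f : KoszulChain r M (i + 1))
    (T : {S : Finset (Fin r) // S.card = i}) :
    koszulD x M i f T ∈ (Ideal.span (Set.range x) • ⊤ : Submodule R M) :=
  Submodule.sum_mem (t := Finset.univ)
    (f := fun j : {j // j ∉ T.1} => (-1 : R) ^ (T.1.filter (· < j.1)).card • x j.1 •
      f (insertIdx T j)) _ fun j _ => Submodule.smul_mem _ _
    (Submodule.smul_mem_smul (Ideal.subset_span ⟨j.1, rfl⟩) trivial)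

lemma koszulD_map {r : ℕ} (x : Fin r → R) {N : Type*} [AddCommGroup N] [Module R N]
    (φ : M →ₗ[R] N) (i : ℕ) (f : KoszulChain r M (i + 1)) :
    koszulD x N i (fun S => φ (f S)) = fun S => φ (koszulD x M i f S) := by
  funext T
  simp [koszulD, map_sum, map_smul]

/-- The projection of the Koszul complex of `x` on `M` to that of the tail of `x` on
`M / x₀ M`. -/
def koszulProj {r : ℕ} (a : R) (i : ℕ) :
    KoszulChain (r + 1) M i →ₗ[R] KoszulChain r (QuotSMulTop a M) i :=
  LinearMap.pi fun T => (a • ⊤ : Submodule R M).mkQ ∘ₗ LinearMap.proj (lowIdx T)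

lemma koszulProj_apply {r : ℕ} (a : R) (i : ℕ) (f : KoszulChain (r + 1) M i)
    (T : {S : Finset (Fin r) // S.card = i}) :
    koszulProj a i f T = Submodule.Quotient.mk (f (lowIdx T)) := rfl

/-- The cone term x₀ f(`highIdx T`) dies modulo x₀, so the projection is a chain map. -/
lemma koszulD_koszulProj {r : ℕ} (x : Fin (r + 1) → R) (i : ℕ)
    (f : KoszulChain (r + 1) M (i + 1)) :
    koszulD (Fin.tail x) (QuotSMulTop (x 0) M) i (koszulProj (x 0) (i + 1) f) =
      koszulProj (x 0) i (koszulD x M i f) := by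
  have h := koszulD_map (Fin.tail x) (x 0 • ⊤ : Submodule R M).mkQ i (fun S => f (lowIdx S))
  refine h.trans ?_
  funext T
  rw [koszulProj_apply, koszulD_lowIdx, Submodule.Quotient.mk_add]
  rw [(Submodule.Quotient.mk_eq_zero _).2
    (Submodule.smul_mem_pointwise_smul _ _ _ Submodule.mem_top),
    add_zero]
  rfl

lemma exists_smul_eq_of_mk_eq_zero {r i : ℕ} {a : R} {f : KoszulChain r M i}
    (h : ∀ T, (Submodule.Quotient.mk (f T) : QuotSMulTop a M) = 0) :
    ∃ u : KoszulChain r M i, a • u = f := by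
  have h' : ∀ T, ∃ m, a • m = f T := fun T => by
    have := (Submodule.Quotient.mk_eq_zero _).1 (h T)
    rw [Submodule.mem_smul_pointwise_iff_exists] at this
    obtain ⟨m, -, hm⟩ := this
    exact ⟨m, hm⟩
  choose u hu using h'
  exact ⟨u, funext hu⟩

lemma exists_koszulChain_lift {r i : ℕ} {a : R} (f : KoszulChain r (QuotSMulTop a M) i) :
    ∃ v : KoszulChain r M i, ∀ T, Submodule.Quotient.mk (v T) = f T := by
  choose v hv using fun T => Submodule.mkQ_surjective _ (f T)
  exact ⟨v, hv⟩

variable {r : ℕ} {x : Fin (r + 1) → R}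

/-- For a lift v of y one has dv = x₀u, and v - e₀ ∧ u is a cycle once du = 0. Indeed x₀ du = ddv =
0, and du has entries in IM, which meets 0 :_M x₀ trivially. -/
lemma IsDSequence.exists_cycle_lift (hs : IsDSequence x M) (i : ℕ)
    {y : KoszulChain r (QuotSMulTop (x 0) M) (i + 1)}
    (hy : koszulD (Fin.tail x) (QuotSMulTop (x 0) M) i y = 0) :
    ∃ z : KoszulChain (r + 1) M (i + 1), koszulD x M i z = 0 ∧ koszulProj (x 0) (i + 1) z = y := by
  obtain ⟨v, hv⟩ := exists_koszulChain_lift y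
  have hv' : y = fun S => (x 0 • ⊤ : Submodule R M).mkQ (v S) := (funext hv).symm
  rw [hv', koszulD_map] at hy
  obtain ⟨u, hu⟩ := exists_smul_eq_of_mk_eq_zero fun T => congrFun hy T
  refine ⟨joinChain v (-u), ?_, funext fun T => by rw [koszulProj_apply, joinChain_lowIdx, hv]⟩
  have hlow : ∀ T, koszulD x M i (joinChain v (-u)) (lowIdx T) =
      (0 : KoszulChain (r + 1) M i) (lowIdx T) := by
    intro T
    rw [koszulD_lowIdx]
    simp only [joinChain_lowIdx, joinChain_highIdx]
    change koszulD (Fin.tail x) M i v T + x 0 • (-u T) = 0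
    rw [← congrFun hu T, Pi.smul_apply, smul_neg, add_neg_cancel]
  rcases i with _ | i
  · exact koszulChain_zero_ext hlow
  · refine koszulChain_ext hlow fun T => ?_
    rw [koszulD_highIdx]
    simp only [joinChain_highIdx]
    change -koszulD (Fin.tail x) M i (-u) T = 0
    rw [map_neg, Pi.neg_apply, neg_neg]
    refine hs.eq_zero_of_mem ?_ ?_
    · change (x 0 • koszulD (Fin.tail x) M i u) T = 0
      rw [← map_smul, hu]
      exact congrFun (koszulD_comp (Fin.tail x) M i v) T
    · rw [← span_range_tail]
      exact Submodule.smul_mono_left le_sup_left (koszulD_mem (Fin.tail x) i u T)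

/-- Both components of the boundary vanish because every x_j kills 0 :_M x₀. -/
lemma IsDSequence.joinChain_cycle (hs : IsDSequence x M) (i : ℕ) {w : KoszulChain r M i}
    (hw : ∀ T, x 0 • w T = 0) : koszulD x M i (joinChain 0 w) = 0 := by
  have hlow : ∀ T, koszulD x M i (joinChain 0 w) (lowIdx T) =
      (0 : KoszulChain (r + 1) M i) (lowIdx T) := by
    intro T
    rw [koszulD_lowIdx]
    simp only [joinChain_lowIdx, joinChain_highIdx, hw, add_zero]
    exact congrFun (map_zero (koszulD (Fin.tail x) M i)) T
  rcases i with _ | i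
  · exact koszulChain_zero_ext hlow
  · refine koszulChain_ext hlow fun T => ?_
    rw [koszulD_highIdx]
    simp only [joinChain_highIdx]
    change -koszulD (Fin.tail x) M i w T = 0
    rw [neg_eq_zero]
    rw [koszulD_apply]
    refine Finset.sum_eq_zero fun j _ => ?_
    by_cases h : j ∈ T.1
    · exact dif_neg (not_not.2 h)
    · rw [dif_pos h, show Fin.tail x j = x j.succ from rfl, hs.smul_eq_zero _ (hw _), smul_zero]

/-- Lift y to c and write the low part of z as dc + x₀v. Subtracting d(c + e₀ ∧ v) leaves e₀ ∧ w
with w = z_high + dv, and the low part of dz = 0 reads x₀w = 0. -/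
lemma exists_sub_joinChain_eq_koszulD (i : ℕ) {z : KoszulChain (r + 1) M (i + 1)}
    (hz : koszulD x M i z = 0) {y : KoszulChain r (QuotSMulTop (x 0) M) (i + 1 + 1)}
    (hy : koszulD (Fin.tail x) (QuotSMulTop (x 0) M) (i + 1) y = koszulProj (x 0) (i + 1) z) :
    ∃ w : KoszulChain r M i, (∀ T, x 0 • w T = 0) ∧
      ∃ b, koszulD x M (i + 1) b = z - joinChain 0 w := by
  obtain ⟨c, hc⟩ := exists_koszulChain_lift y
  have hc' : y = fun S => (x 0 • ⊤ : Submodule R M).mkQ (c S) := (funext hc).symm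
  rw [hc', koszulD_map] at hy
  obtain ⟨v, hv⟩ := exists_smul_eq_of_mk_eq_zero (a := x 0)
    (f := fun T => z (lowIdx T) - koszulD (Fin.tail x) M (i + 1) c T) (fun T => by
      rw [Submodule.Quotient.mk_sub, sub_eq_zero]
      exact (congrFun hy T).symm)
  have hzl : (fun T => z (lowIdx T)) = koszulD (Fin.tail x) M (i + 1) c + x 0 • v := by
    rw [hv]
    funext T
    simp
  refine ⟨fun T => z (highIdx T) + koszulD (Fin.tail x) M i v T, fun T => ?_, joinChain c v, ?_⟩
  · have h := congrFun hz (lowIdx T)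
    rw [koszulD_lowIdx, hzl, map_add, koszulD_comp, zero_add, map_smul] at h
    rw [smul_add, add_comm]
    exact h
  · refine koszulChain_ext (fun T => ?_) fun T => ?_
    · rw [koszulD_lowIdx, Pi.sub_apply, congrFun hzl T]
      simp only [joinChain_lowIdx, joinChain_highIdx]
      simp
    · rw [koszulD_highIdx, Pi.sub_apply]
      simp only [joinChain_highIdx]
      simp

/-- Boundaries have entries in IM, which meets 0 :_M x₀ trivially. -/
lemma IsDSequence.eq_zero_of_joinChain_eq_koszulD (hs : IsDSequence x M) (i : ℕ)
    {w : KoszulChain r M i} (hw : ∀ T, x 0 • w T = 0) {b : KoszulChain (r + 1) M (i + 1 + 1)}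
    (hb : koszulD x M (i + 1) b = joinChain 0 w) : w = 0 := by
  funext T
  refine hs.eq_zero_of_mem (hw T) ?_
  rw [← joinChain_highIdx 0 w T, ← hb]
  exact koszulD_mem x (i + 1) b _

/-- The lengths of the Koszul homology modules of a `d`-sequence, recursively. -/
theorem IsDSequence.length_koszulHomology_succ (hs : IsDSequence x M) (i : ℕ) :
    Module.length R (KoszulHomology x M (i + 1)) =
      r.choose i * Module.length R (Submodule.torsionBy R M (x 0)) +
        Module.length R (KoszulHomology (Fin.tail x) (QuotSMulTop (x 0) M) (i + 1)) := by
  -- The projection is onto in homology, since cycles lift; it remains to measure its kernel.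
  have h1 := subLength_eq_add_of_map (koszulProj (M := M) (r := r) (x 0) (i + 1))
    (P := koszulCycles x M (i + 1)) (Q := LinearMap.range (koszulD x M (i + 1)))
    (P' := koszulCycles (Fin.tail x) (QuotSMulTop (x 0) M) (i + 1))
    (Q' := LinearMap.range (koszulD (Fin.tail x) (QuotSMulTop (x 0) M) (i + 1)))
    (by rintro _ ⟨f, rfl⟩; exact koszulD_comp x M i f)
    (fun z hz => by
      change koszulD _ _ _ _ = 0
      rw [koszulD_koszulProj, show koszulD x M i z = 0 from hz, map_zero])
    (by
      rintro _ ⟨f, rfl⟩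
      exact ⟨_, koszulD_koszulProj x (i + 1) f⟩)
    (fun y hy => by
      obtain ⟨z, hz, hzy⟩ := hs.exists_cycle_lift i (y := y) hy
      refine ⟨z, hz, ?_⟩
      rw [hzy, sub_self]
      exact Submodule.zero_mem _)
  refine h1.trans (congrArg (· + _) ?_)
  -- The map w ↦ e₀ ∧ w on chains with entries in 0 :_M x₀ identifies them with that kernel.
  let f : ({S : Finset (Fin r) // S.card = i} → Submodule.torsionBy R M (x 0)) →ₗ[R]
      KoszulChain (r + 1) M (i + 1) :=
    { toFun w := joinChain 0 fun T => (w T : M)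
      map_add' u v := koszulChain_ext (fun T => by simp) fun T => by simp
      map_smul' a u := koszulChain_ext (fun T => by simp) fun T => by simp }
  have hw (w : {S : Finset (Fin r) // S.card = i} → Submodule.torsionBy R M (x 0)) (T) :
      x 0 • (w T : M) = 0 := (w T).2
  rw [← length_quotient_comap f]
  · have : (LinearMap.range (koszulD x M (i + 1))).comap f = ⊥ := by
      rw [Submodule.eq_bot_iff]
      rintro w ⟨b, hb⟩
      funext T
      exact Subtype.ext (congrFun (hs.eq_zero_of_joinChain_eq_koszulD i (hw w) hb) T)
    rw [this, (Submodule.quotEquivOfEqBot _ rfl).length_eq, Module.length_pi,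
      ENat.card_eq_coe_fintype_card, Fintype.card_finset_len, Fintype.card_fin]
  · refine fun w => ⟨hs.joinChain_cycle i (hw w), ?_⟩
    have : koszulProj (x 0) (i + 1) (f w) = 0 := by
      funext T
      rw [koszulProj_apply]
      simp [f]
    change koszulProj (x 0) (i + 1) (f w) ∈ LinearMap.range (koszulD (Fin.tail x) _ (i + 1))
    rw [this]
    exact Submodule.zero_mem _
  · intro z hzm
    obtain ⟨hz, y, hy⟩ := hzm
    obtain ⟨w, hw0, b, hb⟩ := exists_sub_joinChain_eq_koszulD i hz hy
    exact ⟨fun T => ⟨w T, hw0 T⟩, b, hb⟩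

lemma length_koszulHomology_eq_zero_of_lt {x : Fin r → R} {i : ℕ} (hi : r < i) :
    Module.length R (KoszulHomology x M i) = 0 := by
  have : IsEmpty {S : Finset (Fin r) // S.card = i} := ⟨fun S => by
    have := S.1.card_le_univ
    rw [S.2, Fintype.card_fin] at this
    omega⟩
  exact Module.length_eq_zero

/-- A `d`-sequence is weakly regular iff its first Koszul homology vanishes. -/
theorem IsDSequence.isWeaklyRegular_iff {r : ℕ} {x : Fin r → R} {M : Type*} [AddCommGroup M]
    [Module R M] (hs : IsDSequence x M) :
    RingTheory.Sequence.IsWeaklyRegular M (List.ofFn x) ↔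
      Module.length R (KoszulHomology x M 1) = 0 := by
  induction r generalizing M with
  | zero => simp [length_koszulHomology_eq_zero_of_lt]
  | succ r ih =>
    -- In degree 1 the recursion reads h₁ = λ(0 :_M x₀) + h₁', which matches the inductive
    -- definition of weak regularity.
    rw [List.ofFn_succ, RingTheory.Sequence.isWeaklyRegular_cons_iff,
      hs.length_koszulHomology_succ 0, Nat.choose_zero_right, Nat.cast_one, one_mul,
      add_eq_zero, Module.length_eq_zero_iff, ← ih hs.tail, isSMulRegular_iff_right_eq_zero_of_smul,
      Submodule.subsingleton_iff_eq_bot, Submodule.eq_bot_iff]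
    rfl

/-- Rigidity: h₁ = 0 forces the annihilator to vanish at each stage, and the recursion has no other
contribution in any degree. -/
lemma IsDSequence.length_koszulHomology_eq_zero {r : ℕ} {x : Fin r → R} {M : Type*}
    [AddCommGroup M] [Module R M] (hs : IsDSequence x M)
    (h : Module.length R (KoszulHomology x M 1) = 0) (i : ℕ) :
    Module.length R (KoszulHomology x M (i + 1)) = 0 := by
  induction r generalizing M with
  | zero => exact length_koszulHomology_eq_zero_of_lt (by omega)
  | succ r ih =>
    rw [hs.length_koszulHomology_succ 0, Nat.choose_zero_right, Nat.cast_one, one_mul,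
      add_eq_zero] at h
    rw [hs.length_koszulHomology_succ i, h.1, mul_zero, zero_add, ih hs.tail h.2]

end Koszul

/-! ### Presentations of the associated graded module -/

section Presentation

variable {R : Type*} [CommRing R] {M : Type*} [AddCommGroup M] [Module R M]

/-- The map `f ↦ ∑ i, c i • f i`. -/
def evalMap {ι : Type*} [Fintype ι] (c : ι → R) (M : Type*) [AddCommGroup M] [Module R M] :
    (ι → M) →ₗ[R] M := ∑ i, c i • LinearMap.proj i

lemma evalMap_apply {ι : Type*} [Fintype ι] (c : ι → R) (f : ι → M) :
    evalMap c M f = ∑ i, c i • f i := by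
  simp [evalMap]

lemma evalMap_map {ι : Type*} [Fintype ι] (c : ι → R) {N : Type*} [AddCommGroup N] [Module R N]
    (φ : M →ₗ[R] N) (f : ι → M) : evalMap c N (fun i => φ (f i)) = φ (evalMap c M f) := by
  simp [evalMap_apply]

lemma evalMap_mem {ι : Type*} [Fintype ι] {c : ι → R} {J : Ideal R} (hc : ∀ i, c i ∈ J)
    {N : Submodule R M} {f : ι → M} (hf : ∀ i, f i ∈ N) : evalMap c M f ∈ J • N := by
  rw [evalMap_apply]
  exact Submodule.sum_mem _ fun i _ => Submodule.smul_mem_smul (hc i) (hf i)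

/-- `I^n M / I^{n+1} M` is a quotient of `(M / I M)^N`, through a map given by multiplications by
elements of `I^n`, whose kernel has length `κ`. -/
def HasPresentation (I : Ideal R) (M : Type*) [AddCommGroup M] [Module R M] (n N : ℕ) (κ : ℕ∞) :
    Prop :=
  ∃ (ι : Type) (_ : Fintype ι) (c : ι → R), Fintype.card ι = N ∧ (∀ i, c i ∈ I ^ n) ∧
    (I ^ n • ⊤ : Submodule R M) ≤ LinearMap.range (evalMap c M) ⊔ I ^ (n + 1) • ⊤ ∧
    subLength ((I ^ (n + 1) • ⊤ : Submodule R M).comap (evalMap c M))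
      (Submodule.pi Set.univ fun _ => I • ⊤) = κ

lemma hasPresentation_zero (I : Ideal R) : HasPresentation I M 0 1 0 := by
  refine ⟨Unit, inferInstance, fun _ => 1, rfl, fun _ => by simp, ?_, ?_⟩
  · intro m _
    exact Submodule.mem_sup_left ⟨fun _ => m, by simp [evalMap_apply]⟩
  · convert subLength_self _ using 2
    ext f
    simpa [evalMap_apply] using ⟨fun h => h (), fun h _ => h⟩

lemma hasPresentation_bot (n : ℕ) : HasPresentation (⊥ : Ideal R) M (n + 1) 0 0 := by
  refine ⟨Fin 0, inferInstance, Fin.elim0, rfl, fun i => i.elim0, ?_, ?_⟩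
  · rw [← Ideal.zero_eq_bot, zero_pow n.succ_ne_zero, Ideal.zero_eq_bot, Submodule.bot_smul]
    exact bot_le
  · exact Module.length_eq_zero

/-- Hence `evalMap c` descends to (M/IM)^ι → I^nM / I^{n+1}M, and the quotient of these two
submodules is its kernel. -/
lemma pi_le_comap_evalMap {I : Ideal R} {n : ℕ} {ι : Type*} [Fintype ι] {c : ι → R}
    (hc : ∀ i, c i ∈ I ^ n) : (Submodule.pi Set.univ fun _ => (I • ⊤ : Submodule R M)) ≤
      (I ^ (n + 1) • ⊤ : Submodule R M).comap (evalMap c M) := by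
  intro f hf
  rw [Submodule.mem_comap, pow_succ, Submodule.mul_smul]
  exact evalMap_mem hc fun i => hf i trivial

lemma smul_mem_pow_succ {I : Ideal R} {a : R} (ha : a ∈ I) {n : ℕ} {m : M}
    (hm : m ∈ (I ^ n • ⊤ : Submodule R M)) : a • m ∈ (I ^ (n + 1) • ⊤ : Submodule R M) := by
  rw [pow_succ', Submodule.mul_smul]
  exact Submodule.smul_mem_smul ha hm

variable {r : ℕ} {x : Fin (r + 1) → R}

lemma span_range_tail_le (x : Fin (r + 1) → R) :
    Ideal.span (Set.range (Fin.tail x)) ≤ Ideal.span (Set.range x) := by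
  rw [← span_range_tail x]
  exact le_sup_left

lemma mk_mem_pow_of_mem {k : ℕ} {m : M}
    (hm : m ∈ (Ideal.span (Set.range x) ^ k • ⊤ : Submodule R M)) :
    (Submodule.Quotient.mk m : QuotSMulTop (x 0) M) ∈
      (Ideal.span (Set.range (Fin.tail x)) ^ k • ⊤ : Submodule R (QuotSMulTop (x 0) M)) := by
  rw [mk_mem_smul_top_iff]
  refine Submodule.smul_mono_left ?_ hm
  rw [← span_range_tail x]
  exact sup_pow_le _ _ k

lemma mk_mem_span_range_tail {m : M} :
    (Submodule.Quotient.mk m : QuotSMulTop (x 0) M) ∈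
      (Ideal.span (Set.range (Fin.tail x)) • ⊤ : Submodule R (QuotSMulTop (x 0) M)) ↔
      m ∈ (Ideal.span (Set.range x) • ⊤ : Submodule R M) := by
  rw [mk_mem_smul_top_iff, span_range_tail]

/-- Exactness of gr_n(M) → gr_{n+1}(M) → gr_{n+1}(M / x₀M), the first map being x₀. Modulo I^{n+2}M
the element m has the form x₀y, and x₀M ∩ I^{n+1}M = x₀ I^n M allows y ∈ I^n M, which the generators
then express. -/
lemma IsDSequence.exists_sub_smul_mem (hs : IsDSequence x M) {n : ℕ} {ι : Type*} [Fintype ι]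
    {c : ι → R} (hgen : (Ideal.span (Set.range x) ^ n • ⊤ : Submodule R M) ≤
      LinearMap.range (evalMap c M) ⊔ Ideal.span (Set.range x) ^ (n + 1) • ⊤) {m : M}
    (hm : m ∈ (Ideal.span (Set.range x) ^ (n + 1) • ⊤ : Submodule R M))
    (hm' : (Submodule.Quotient.mk m : QuotSMulTop (x 0) M) ∈
      (Ideal.span (Set.range (Fin.tail x)) ^ (n + 1 + 1) • ⊤ :
        Submodule R (QuotSMulTop (x 0) M))) :
    ∃ g, m - x 0 • evalMap c M g ∈
      (Ideal.span (Set.range x) ^ (n + 1 + 1) • ⊤ : Submodule R M) := by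
  have hx : x 0 ∈ Ideal.span (Set.range x) := Ideal.subset_span ⟨0, rfl⟩
  rw [mk_mem_smul_top_iff, mem_sup_span_smul_iff] at hm'
  obtain ⟨u, hu, y, -, rfl⟩ := hm'
  replace hu := Submodule.smul_mono_left (N := (⊤ : Submodule R M))
    (Ideal.pow_right_mono (span_range_tail_le x) (n + 1 + 1)) hu
  have hu' := Submodule.smul_mono_left (N := (⊤ : Submodule R M))
    (Ideal.pow_le_pow_right (n + 1).le_succ) hu
  obtain ⟨y', hy', h⟩ := hs.exists_of_smul_mem_pow
    ((Submodule.add_mem_iff_right _ hu').1 hm)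
  obtain ⟨_, ⟨g, rfl⟩, w, hw, rfl⟩ := Submodule.mem_sup.1 (hgen hy')
  refine ⟨g, ?_⟩
  rw [← h, smul_add, add_sub_assoc, add_sub_cancel_left]
  exact Submodule.add_mem _ hu (smul_mem_pow_succ hx hw)

/-- The kernel of multiplication by `x₀` from degree `n` to degree `n + 1` of the associated
graded module. -/
lemma IsDSequence.subLength_smul (hs : IsDSequence x M) {n : ℕ} {ι : Type*} [Fintype ι]
    {c : ι → R} (hc : ∀ i, c i ∈ Ideal.span (Set.range x) ^ n)
    (hgen : (Ideal.span (Set.range x) ^ n • ⊤ : Submodule R M) ≤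
      LinearMap.range (evalMap c M) ⊔ Ideal.span (Set.range x) ^ (n + 1) • ⊤) :
    subLength ((Ideal.span (Set.range x) ^ (n + 1 + 1) • ⊤ : Submodule R M).comap
        (x 0 • evalMap c M))
      ((Ideal.span (Set.range x) ^ (n + 1) • ⊤ : Submodule R M).comap (evalMap c M)) =
    if n = 0 then Module.length R (Submodule.torsionBy R M (x 0)) else 0 := by
  have hx : x 0 ∈ Ideal.span (Set.range x) := Ideal.subset_span ⟨0, rfl⟩
  have hle : (Ideal.span (Set.range x) ^ (n + 1) • ⊤ : Submodule R M).comap (evalMap c M) ≤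
      (Ideal.span (Set.range x) ^ (n + 1 + 1) • ⊤ : Submodule R M).comap (x 0 • evalMap c M) :=
    fun g hg => smul_mem_pow_succ hx hg
  -- A kernel element differs from one of I^{n+1}M by an element of 0 :_M x₀.
  have hex : ∀ g, x 0 • evalMap c M g ∈
      (Ideal.span (Set.range x) ^ (n + 1 + 1) • ⊤ : Submodule R M) →
      ∃ m ∈ (Ideal.span (Set.range x) ^ (n + 1) • ⊤ : Submodule R M),
        x 0 • (evalMap c M g - m) = 0 := by
    intro g hg
    obtain ⟨m, hm, h⟩ := hs.exists_of_smul_mem_pow hg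
    exact ⟨m, hm, by rw [smul_sub, h, sub_self]⟩
  split_ifs with hn
  · subst hn
    -- In degree 0 the kernel is (A + IM) / IM with A = 0 :_M x₀, isomorphic to A because A ∩ IM =
    -- 0.
    have h1 := subLength_eq_of_map (evalMap c M) hle
      (P' := Submodule.torsionBy R M (x 0) ⊔ Ideal.span (Set.range x) ^ (0 + 1) • ⊤)
      (Q' := Ideal.span (Set.range x) ^ (0 + 1) • ⊤) (fun g hg => by
        obtain ⟨m, hm, h⟩ := hex g hg
        rw [← sub_add_cancel (evalMap c M g) m]
        exact Submodule.add_mem_sup ((Submodule.mem_torsionBy_iff _ _).2 h) hm)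
      (fun g _ => Iff.rfl) (fun y hy => by
        obtain ⟨_, ⟨g, rfl⟩, w, hw, rfl⟩ := Submodule.mem_sup.1 (hgen (x := y) (by simp))
        refine ⟨g, ?_, by rwa [add_sub_cancel_left]⟩
        obtain ⟨u, hu, v, hv, h⟩ := Submodule.mem_sup.1 hy
        rw [Submodule.mem_torsionBy_iff] at hu
        change x 0 • evalMap c M g ∈ (Ideal.span (Set.range x) ^ (0 + 1 + 1) • ⊤ : Submodule R M)
        rw [← add_sub_cancel_right (evalMap c M g) w, ← h, add_sub_assoc, smul_add, hu,
          zero_add (x 0 • _)]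
        exact smul_mem_pow_succ hx (Submodule.sub_mem _ hv hw))
    rw [h1, ← subLength_bot]
    symm
    refine subLength_eq_of_map LinearMap.id bot_le (fun y hy => Submodule.mem_sup_left hy)
      (fun y hy => ⟨fun h => ?_, fun h => ?_⟩) fun y hy => ?_
    · rw [zero_add, pow_one] at h
      exact hs.eq_zero_of_mem hy h
    · rw [(Submodule.mem_bot R).1 h]
      exact Submodule.zero_mem _
    · obtain ⟨u, hu, v, hv, rfl⟩ := Submodule.mem_sup.1 hy
      exact ⟨u, hu, by simpa using hv⟩
  · convert subLength_self _ using 2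
    refine le_antisymm hle fun g hg => ?_
    obtain ⟨m, hm, h⟩ := hex g hg
    have hpow : ∀ {k : ℕ}, k ≠ 0 → ∀ m ∈ (Ideal.span (Set.range x) ^ k • ⊤ : Submodule R M),
        m ∈ (Ideal.span (Set.range x) • ⊤ : Submodule R M) := fun hk m hm =>
      Submodule.smul_mono_left (Ideal.pow_le_self hk) hm
    -- For n > 0 the difference also lies in IM, so it vanishes.
    have h0 := hs.eq_zero_of_mem h (Submodule.sub_mem _
      (hpow hn _ (evalMap_mem hc fun _ => Submodule.mem_top)) (hpow n.succ_ne_zero m hm))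
    rw [Submodule.mem_comap, sub_eq_zero.1 h0]
    exact hm

lemma evalMap_sumElim {ι ι' : Type*} [Fintype ι] [Fintype ι'] (a : R) (c : ι → R) (c' : ι' → R)
    (f : ι ⊕ ι' → M) : evalMap (Sum.elim (fun i => a * c i) c') M f =
      a • evalMap c M (fun i => f (Sum.inl i)) + evalMap c' M fun i => f (Sum.inr i) := by
  simp [evalMap_apply, Fintype.sum_sum_type, Finset.smul_sum, mul_smul]

/-- New generators are x₀ times those of degree n, and those of M / x₀M in degree n + 1. The kernel
projects onto the kernel κ' for M / x₀M; what remains is the kernel of x₀ composed with the old map,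
that is, κ plus the kernel of x₀ on gr_n(M). -/
theorem IsDSequence.hasPresentation_succ (hs : IsDSequence x M) {n N N' : ℕ} {κ κ' : ℕ∞}
    (h : HasPresentation (Ideal.span (Set.range x)) M n N κ)
    (h' : HasPresentation (Ideal.span (Set.range (Fin.tail x))) (QuotSMulTop (x 0) M)
      (n + 1) N' κ') :
    HasPresentation (Ideal.span (Set.range x)) M (n + 1) (N + N')
      (κ + κ' + if n = 0 then Module.length R (Submodule.torsionBy R M (x 0)) else 0) := by
  obtain ⟨ι, _, c, rfl, hc, hgen, rfl⟩ := h
  obtain ⟨ι', _, c', rfl, hc', hgen', rfl⟩ := h'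
  have hx : x 0 ∈ Ideal.span (Set.range x) := Ideal.subset_span ⟨0, rfl⟩
  have hc'' : ∀ i, c' i ∈ Ideal.span (Set.range x) ^ (n + 1) := fun i =>
    Ideal.pow_right_mono (span_range_tail_le x) (n + 1) (hc' i)
  have hcs : ∀ i, Sum.elim (fun i => x 0 * c i) c' i ∈ Ideal.span (Set.range x) ^ (n + 1) := by
    rintro (i | i)
    · rw [pow_succ']
      exact Ideal.mul_mem_mul hx (hc i)
    · exact hc'' i
  have hmk : ∀ f : ι' → M, evalMap c' (QuotSMulTop (x 0) M) (fun i => Submodule.Quotient.mk (f i)) =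
      Submodule.Quotient.mk (evalMap c' M f) := fun f =>
    evalMap_map c' (x 0 • ⊤ : Submodule R M).mkQ f
  have hlift : ∀ f : ι' → QuotSMulTop (x 0) M, ∃ g : ι' → M,
      (fun i => Submodule.Quotient.mk (g i)) = f := fun f => by
    choose g hg using fun i => Submodule.mkQ_surjective _ (f i)
    exact ⟨g, funext hg⟩
  refine ⟨ι ⊕ ι', inferInstance, Sum.elim (fun i => x 0 * c i) c', Fintype.card_sum, hcs, ?_, ?_⟩
  · intro m hm
    obtain ⟨_, ⟨f, rfl⟩, w, hw, hfw⟩ := Submodule.mem_sup.1 (hgen' (mk_mem_pow_of_mem hm))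
    obtain ⟨f, rfl⟩ := hlift f
    rw [hmk] at hfw
    have h1 : (Submodule.Quotient.mk (m - evalMap c' M f) : QuotSMulTop (x 0) M) = w := by
      rw [Submodule.Quotient.mk_sub, ← hfw, add_sub_cancel_left]
    obtain ⟨g, hg⟩ := hs.exists_sub_smul_mem hgen (m := m - evalMap c' M f)
      (Submodule.sub_mem _ hm (evalMap_mem hc'' fun _ => Submodule.mem_top)) (h1 ▸ hw)
    refine Submodule.mem_sup.2 ⟨_, ⟨Sum.elim g f, rfl⟩, _, hg, ?_⟩
    rw [evalMap_sumElim]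
    simp only [Sum.elim_inl, Sum.elim_inr]
    abel
  · let p : (ι ⊕ ι' → M) →ₗ[R] (ι' → QuotSMulTop (x 0) M) :=
      LinearMap.pi fun i => (x 0 • ⊤ : Submodule R M).mkQ ∘ₗ LinearMap.proj (Sum.inr i)
    let q : (ι ⊕ ι' → M) →ₗ[R] (ι → M) := LinearMap.pi fun i => LinearMap.proj (Sum.inl i)
    -- Reduction of the second block of coordinates modulo x₀; a relation over M / x₀M lifts after a
    -- correction in the first block.
    have h1 := subLength_eq_add_of_map p (pi_le_comap_evalMap (M := M) hcs)
      (P' := (Ideal.span (Set.range (Fin.tail x)) ^ (n + 1 + 1) • ⊤ :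
        Submodule R (QuotSMulTop (x 0) M)).comap (evalMap c' (QuotSMulTop (x 0) M)))
      (Q' := Submodule.pi Set.univ fun _ => Ideal.span (Set.range (Fin.tail x)) • ⊤)
      (fun f hf => by
        have hf := mk_mem_pow_of_mem hf
        rw [evalMap_sumElim, Submodule.Quotient.mk_add, (Submodule.Quotient.mk_eq_zero _).2
          (Submodule.smul_mem_pointwise_smul _ _ _ Submodule.mem_top), zero_add, ← hmk] at hf
        exact hf)
      (fun f hf i _ => mk_mem_span_range_tail.2 (hf (Sum.inr i) trivial))
      (fun y hy => by
        obtain ⟨f, rfl⟩ := hlift y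
        rw [Submodule.mem_comap, hmk] at hy
        obtain ⟨g, hg⟩ := hs.exists_sub_smul_mem hgen
          (evalMap_mem hc'' fun _ => Submodule.mem_top) hy
        refine ⟨Sum.elim (-g) f, ?_, ?_⟩
        · rw [Submodule.mem_comap, evalMap_sumElim]
          simp only [Sum.elim_inl, Sum.elim_inr]
          change x 0 • evalMap c M (-g) + evalMap c' M f ∈ _
          rwa [map_neg, smul_neg, neg_add_eq_sub]
        · convert Submodule.zero_mem _
          exact sub_self _)
    -- In the kernel of `p` the second block lies in IM and contributes only to I^{n+2}M, so the
    -- first block alone matters.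
    have h2 := subLength_eq_of_map q
      (P := (Ideal.span (Set.range x) ^ (n + 1 + 1) • ⊤ : Submodule R M).comap
        (evalMap (Sum.elim (fun i => x 0 * c i) c') M) ⊓
        (Submodule.pi Set.univ fun _ => Ideal.span (Set.range (Fin.tail x)) • ⊤).comap p)
      (Q := Submodule.pi Set.univ fun _ => Ideal.span (Set.range x) • ⊤)
      (P' := (Ideal.span (Set.range x) ^ (n + 1 + 1) • ⊤ : Submodule R M).comap
        (x 0 • evalMap c M))
      (Q' := Submodule.pi Set.univ fun _ => Ideal.span (Set.range x) • ⊤)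
      (le_inf (pi_le_comap_evalMap hcs) fun f hf i _ =>
        mk_mem_span_range_tail.2 (hf (Sum.inr i) trivial))
      (fun f hf => by
        have h3 := hf.1
        rw [SetLike.mem_coe, Submodule.mem_comap, evalMap_sumElim] at h3
        refine (Submodule.add_mem_iff_left (Ideal.span (Set.range x) ^ (n + 1 + 1) • ⊤)
          (pi_le_comap_evalMap hc'' fun i _ => ?_)).1 h3
        exact mk_mem_span_range_tail.1 (hf.2 i trivial))
      (fun f hf => ⟨fun h i _ => by
        rcases i with i | i
        · exact h i trivial
        · exact mk_mem_span_range_tail.1 (hf.2 i trivial), fun h i _ => h (Sum.inl i) trivial⟩)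
      (fun g hg => by
        refine ⟨Sum.elim g 0, ⟨?_, ?_⟩, ?_⟩
        · rw [SetLike.mem_coe, Submodule.mem_comap, evalMap_sumElim]
          simp only [Sum.elim_inl, Sum.elim_inr]
          change x 0 • evalMap c M g + evalMap c' M 0 ∈ _
          rw [map_zero, add_zero]
          exact hg
        · exact fun i _ => Submodule.zero_mem _
        · convert Submodule.zero_mem _
          exact sub_self _)
    have h3 : (Ideal.span (Set.range x) ^ (n + 1) • ⊤ : Submodule R M).comap (evalMap c M) ≤
        (Ideal.span (Set.range x) ^ (n + 1 + 1) • ⊤ : Submodule R M).comap (x 0 • evalMap c M) :=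
      fun g hg => smul_mem_pow_succ (m := evalMap c M g) hx hg
    rw [h1, h2, subLength_add_of_le (pi_le_comap_evalMap hc) h3,
      hs.subLength_smul hc hgen, add_right_comm]

end Presentation

/-! ### Lengths of the components of the 𝐣-transform -/

section Transform

open IsLocalRing

variable {R : Type*} [CommRing R] [IsLocalRing R] {M : Type*} [AddCommGroup M] [Module R M]

/-- A presentation with a kernel of finite length computes the components of the
`𝐣`-transform. -/
theorem HasPresentation.length_jComponent {I : Ideal R} {n N : ℕ} {κ : ℕ∞}
    (h : HasPresentation I M n N κ) (hκ : κ ≠ ⊤) :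
    κ + Module.length R (jComponent I M n) =
      N * subLength (saturation (I • ⊤ : Submodule R M)) (I • ⊤) := by
  obtain ⟨ι, _, c, rfl, hc, hgen, rfl⟩ := h
  obtain ⟨l, hl⟩ := exists_pow_smul_mem_of_subLength_ne_top hκ
  -- A kernel of finite length is 𝔪-power torsion, so it lies in H⁰_𝔪(M/IM)^ι.
  have hsat : (I ^ (n + 1) • ⊤ : Submodule R M).comap (evalMap c M) ≤
      Submodule.pi Set.univ fun _ => saturation (I • ⊤ : Submodule R M) := fun f hf i _ =>
    mem_saturation.2 ⟨l, fun a ha => hl a ha f hf i trivial⟩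
  rw [← subLength_pi, jComponent_eq, length_localH0_subquotient,
    subLength_eq_add_of_map (evalMap c M)
      (Q' := (I ^ (n + 1) • ⊤ : Submodule R M))
      (P' := saturation (I ^ (n + 1) • ⊤ : Submodule R M) ⊓ I ^ n • ⊤)
      (Submodule.pi_mono fun _ _ => le_saturation _) (fun f hf => ⟨?_, ?_⟩)
      (fun f hf => pi_le_comap_evalMap hc hf) (fun y hy => ?_), inf_eq_right.2 hsat]
  · rw [evalMap_apply]
    refine Submodule.sum_mem _ fun i _ => ?_
    obtain ⟨k, hk⟩ := mem_saturation.1 (hf i trivial)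
    refine mem_saturation.2 ⟨k, fun a ha => ?_⟩
    rw [smul_comm, pow_succ, Submodule.mul_smul]
    exact Submodule.smul_mem_smul (hc i) (hk a ha)
  · exact evalMap_mem hc fun _ => Submodule.mem_top
  · obtain ⟨_, ⟨f, rfl⟩, w, hw, rfl⟩ := Submodule.mem_sup.1 (hgen hy.2)
    refine ⟨f, fun i _ => ?_, by rwa [add_sub_cancel_left]⟩
    obtain ⟨k, hk⟩ := mem_saturation.1 hy.1
    -- Here 𝔪^k moves f into the kernel and 𝔪^l kills the kernel, so preimages of torsion elements
    -- are torsion.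
    refine mem_saturation.2 ⟨l + k, fun a ha => ?_⟩
    rw [pow_add] at ha
    refine Submodule.mul_induction_on ha (fun a ha b hb => ?_) fun a b ha hb => ?_
    · rw [mul_smul]
      refine hl a ha (b • f) ?_ i trivial
      have h1 := hk b hb
      rw [smul_add] at h1
      rw [Submodule.mem_comap, map_smul]
      exact (Submodule.add_mem_iff_left _ (Submodule.smul_mem _ _ hw)).1 h1
    · rw [add_smul]
      exact Submodule.add_mem _ ha hb

/-- The coefficient at the empty set identifies H₀(x; M) with M/IM. -/
lemma length_localH0_koszulHomology_zero {r : ℕ} (x : Fin r → R) :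
    Module.length R (localH0 R (KoszulHomology x M 0)) =
      subLength (saturation (Ideal.span (Set.range x) • ⊤ : Submodule R M))
        (Ideal.span (Set.range x) • ⊤) := by
  have hu : ∀ S : {S : Finset (Fin r) // S.card = 0}, S = ⟨∅, rfl⟩ := fun S =>
    Subtype.ext (Finset.card_eq_zero.1 S.2)
  let e : KoszulChain r M 0 →ₗ[R] M := LinearMap.proj ⟨∅, rfl⟩
  have hr : LinearMap.range (koszulD x M 0) =
      (Ideal.span (Set.range x) • ⊤ : Submodule R M).comap e := by
    apply le_antisymm
    · rintro _ ⟨f, rfl⟩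
      exact koszulD_mem x 0 f ⟨∅, rfl⟩
    · let k : M →ₗ[R] KoszulChain r M 0 := LinearMap.pi fun _ => LinearMap.id
      have h1 : (Ideal.span (Set.range x) • ⊤ : Submodule R M) ≤
          (LinearMap.range (koszulD x M 0)).comap k := by
        refine Submodule.smul_le.2 fun a ha m _ => ?_
        refine Submodule.span_induction ?_ ?_ ?_ ?_ ha
        · rintro _ ⟨j, rfl⟩
          -- This is the chain e_j ⊗ m, with boundary x_j m.
          refine ⟨fun S => if j ∈ S.1 then m else 0, funext fun S => ?_⟩
          rw [hu S, koszulD_apply, Finset.sum_eq_single j]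
          · simp [insertIdx, k]
          · intro j' _ hj
            simp [insertIdx, hj.symm]
          · simp
        · rw [zero_smul]
          exact Submodule.zero_mem _
        · intro a b _ _ ha hb
          rw [add_smul]
          exact Submodule.add_mem _ ha hb
        · intro a b _ hb
          rw [smul_assoc]
          exact Submodule.smul_mem _ a hb
      intro f hf
      have h2 : k (e f) = f := funext fun S => by rw [hu S]; rfl
      exact h2 ▸ h1 hf
  rw [length_localH0_subquotient, hr]
  refine subLength_eq_of_map e (le_inf (le_saturation _) le_top) (fun f hf => ?_)
    (fun f _ => Iff.rfl) (fun m hm => ⟨fun _ => m, ⟨?_, trivial⟩, ?_⟩)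
  · obtain ⟨l, hl⟩ := mem_saturation.1 hf.1
    exact mem_saturation.2 ⟨l, fun a ha => hl a ha⟩
  · obtain ⟨l, hl⟩ := mem_saturation.1 hm
    exact mem_saturation.2 ⟨l, fun a ha => hl a ha⟩
  · convert Submodule.zero_mem _
    exact sub_self _

end Transform

/-! ### Generating series -/

section Series

open PowerSeries

variable {R : Type*} [CommRing R]

lemma mk_mul_one_sub_X {u v : ℕ → ℤ} (h0 : u 0 = v 0) (h : ∀ n, u (n + 1) = u n + v (n + 1)) :
    PowerSeries.mk u * (1 - X) = PowerSeries.mk v := by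
  ext n
  rw [mul_sub, mul_one, map_sub]
  rcases n with _ | n
  · simp [h0]
  · rw [coeff_succ_mul_X, coeff_mk, coeff_mk, coeff_mk, h]
    ring

/-- The coefficients are the contributions binom(r, i) λ(A) of the Koszul recursion, with
alternating signs. -/
lemma X_mul_one_sub_X_pow (a : ℤ) (r : ℕ) :
    C a * X * (1 - X) ^ r =
      ∑ i ∈ Finset.range (r + 1), C ((-1) ^ i * (r.choose i * a)) * X ^ (i + 1) := by
  rw [sub_eq_neg_add, add_pow, Finset.mul_sum]
  refine Finset.sum_congr rfl fun i _ => ?_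
  rw [neg_pow, one_pow, mul_one]
  simp only [map_mul, map_pow, map_neg, map_one, map_natCast]
  ring

/-- The Hilbert series of the kernels in the presentations of the associated graded module of a
`d`-sequence with Koszul homology of finite length. -/
theorem IsDSequence.exists_hasPresentation {r : ℕ} {x : Fin r → R} {M : Type*} [AddCommGroup M]
    [Module R M] (hs : IsDSequence x M)
    (ha : ∀ i, Module.length R (KoszulHomology x M (i + 1)) ≠ ⊤) :
    ∃ N κ : ℕ → ℕ, (∀ n, HasPresentation (Ideal.span (Set.range x)) M n (N n) (κ n)) ∧
      (PowerSeries.mk fun n => (N n : ℤ)) * (1 - X) ^ r = 1 ∧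
      (PowerSeries.mk fun n => (κ n : ℤ)) * (1 - X) ^ r = ∑ i ∈ Finset.range r,
        C ((-1) ^ i * ((Module.length R (KoszulHomology x M (i + 1))).toNat : ℤ)) *
          X ^ (i + 1) := by
  induction r generalizing M with
  | zero =>
    refine ⟨fun n => if n = 0 then 1 else 0, fun _ => 0, fun n => ?_, ?_, ?_⟩
    · rcases n with _ | n
      · simpa using hasPresentation_zero (M := M) (Ideal.span (Set.range x))
      · rw [Set.range_eq_empty, Ideal.span_empty]
        simpa using hasPresentation_bot (R := R) (M := M) n
    · ext n
      simp [coeff_one]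
    · ext n
      simp
  | succ r ih =>
    have hlen := fun i => hs.length_koszulHomology_succ i
    have hA : Module.length R (Submodule.torsionBy R M (x 0)) ≠ ⊤ := by
      have h := ha 0
      rw [hlen 0, Nat.choose_zero_right, Nat.cast_one, one_mul] at h
      exact (WithTop.add_ne_top.1 h).1
    have hH : ∀ i, Module.length R
        (KoszulHomology (Fin.tail x) (QuotSMulTop (x 0) M) (i + 1)) ≠ ⊤ := fun i => by
      have h := ha i
      rw [hlen i] at h
      exact (WithTop.add_ne_top.1 h).2
    obtain ⟨N', κ', hP, hN, hκ⟩ := ih hs.tail hH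
    obtain ⟨a, hA⟩ := ENat.ne_top_iff_exists.1 hA
    have hN0 : N' 0 = 1 := by
      have := congrArg constantCoeff hN
      simpa using this
    have hκ0 : κ' 0 = 0 := by
      have := congrArg constantCoeff hκ
      simpa [map_sum] using this
    obtain ⟨N, hNz, hNs⟩ : ∃ N : ℕ → ℕ, N 0 = 1 ∧ ∀ n, N (n + 1) = N n + N' (n + 1) :=
      ⟨fun n => Nat.rec 1 (fun n k => k + N' (n + 1)) n, rfl, fun _ => rfl⟩
    obtain ⟨κ, hκz, hκs⟩ : ∃ κ : ℕ → ℕ, κ 0 = 0 ∧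
        ∀ n, κ (n + 1) = κ n + κ' (n + 1) + if n = 0 then a else 0 :=
      ⟨fun n => Nat.rec 0 (fun n k => k + κ' (n + 1) + if n = 0 then a else 0) n, rfl,
        fun _ => rfl⟩
    refine ⟨N, κ, fun n => ?_, ?_, ?_⟩
    · induction n with
      | zero =>
        rw [hNz, hκz]
        exact hasPresentation_zero _
      | succ n ihn =>
        have h := hs.hasPresentation_succ ihn (hP (n + 1))
        rw [hNs, hκs]
        convert h using 1
        rw [← hA]
        push_cast
        rfl
    · rw [pow_succ', ← mul_assoc, mk_mul_one_sub_X (v := fun n => (N' n : ℤ)), hN]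
      · simp [hNz, hN0]
      · intro n
        simp [hNs]
    -- The recursion for κ as (1 - t) K = K' + a t.
    · have h1 : (PowerSeries.mk fun n => (κ n : ℤ)) * (1 - X) =
          (PowerSeries.mk fun n => (κ' n : ℤ)) + C (a : ℤ) * X := by
        rw [mk_mul_one_sub_X (v := fun n => (κ' n : ℤ) + if n = 1 then (a : ℤ) else 0)]
        · ext n
          simp only [PowerSeries.coeff_mk, map_add, coeff_C_mul, coeff_X, mul_ite, mul_one,
            mul_zero]
        · simp [hκz, hκ0]
        · intro n
          simp [hκs, add_assoc]
      have h2 : ∀ i, ((Module.length R (KoszulHomology x M (i + 1))).toNat : ℤ) =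
          r.choose i * a + (Module.length R
            (KoszulHomology (Fin.tail x) (QuotSMulTop (x 0) M) (i + 1))).toNat := by
        intro i
        obtain ⟨b, hb⟩ := ENat.ne_top_iff_exists.1 (hH i)
        rw [hlen i, ← hA, ← hb]
        norm_cast
      have h3 : ∀ i ∈ Finset.range (r + 1),
          C ((-1) ^ i * ((Module.length R (KoszulHomology x M (i + 1))).toNat : ℤ)) *
            (X : ℤ⟦X⟧) ^ (i + 1) = C ((-1) ^ i * (r.choose i * (a : ℤ))) * X ^ (i + 1) +
          C ((-1) ^ i * ((Module.length R (KoszulHomology (Fin.tail x) (QuotSMulTop (x 0) M)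
            (i + 1))).toNat : ℤ)) * X ^ (i + 1) := fun i _ => by
        rw [h2 i, mul_add, map_add, add_mul]
      rw [pow_succ', ← mul_assoc, h1, add_mul, hκ, X_mul_one_sub_X_pow, Finset.sum_congr rfl h3,
        Finset.sum_add_distrib, add_comm]
      congr 1
      -- The tail has r elements, so its homology in degree r + 1 vanishes and the two ranges of
      -- summation agree.
      rw [Finset.sum_range_succ, length_koszulHomology_eq_zero_of_lt r.lt_succ_self]
      simp

/-- The polynomial `∑ (-1)^i h_i t^i` in powers of `1 - t`. -/
lemma sum_mul_X_pow_eq (r : ℕ) (h : ℕ → ℤ) :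
    ∑ k ∈ Finset.range (r + 1), C ((-1) ^ k * h k) * X ^ k =
      ∑ i ∈ Finset.range (r + 1),
        C ((-1) ^ i * ∑ k ∈ Finset.Icc i r, (-1) ^ k * h k * (k.choose i : ℤ)) *
          (1 - X : ℤ⟦X⟧) ^ i := by
  have h1 : ∀ k ∈ Finset.range (r + 1), C ((-1) ^ k * h k) * (X : ℤ⟦X⟧) ^ k =
      ∑ i ∈ Finset.range (r + 1),
        C ((-1) ^ i * ((-1) ^ k * h k * (k.choose i : ℤ))) * (1 - X) ^ i := by
    intro k hk
    have h2 : (X : ℤ⟦X⟧) = -(1 - X) + 1 := by ring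
    conv_lhs => rw [h2, add_pow, Finset.mul_sum]
    rw [← Finset.sum_subset (Finset.range_subset_range.2 (Finset.mem_range.1 hk))]
    · refine Finset.sum_congr rfl fun i _ => ?_
      rw [neg_pow (1 - X : ℤ⟦X⟧), one_pow, mul_one]
      simp only [map_mul, map_pow, map_neg, map_one, map_natCast]
      generalize (1 - X : ℤ⟦X⟧) = y
      ring
    · intro i _ hi
      rw [Finset.mem_range, not_lt] at hi
      rw [Nat.choose_eq_zero_of_lt (by omega)]
      simp
  rw [Finset.sum_congr rfl h1, Finset.sum_comm]
  refine Finset.sum_congr rfl fun i _ => ?_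
  rw [← Finset.sum_mul, ← map_sum, ← Finset.mul_sum]
  congr 3
  symm
  refine Finset.sum_subset (fun k hk => ?_) fun k hk hk' => ?_
  · rw [Finset.mem_Icc] at hk
    exact Finset.mem_range.2 (by omega)
  · rw [Finset.mem_Icc] at hk'
    rw [Finset.mem_range] at hk
    rw [Nat.choose_eq_zero_of_lt (by omega)]
    simp

/-- The partial sums of a series `(∑ (-1)^k h_k t^k) / (1 - t)^r`. -/
lemma sum_range_eq_of_mul_one_sub_X_pow {r : ℕ} {u h : ℕ → ℤ}
    (hu : PowerSeries.mk u * (1 - X) ^ r = ∑ k ∈ Finset.range (r + 1), C ((-1) ^ k * h k) * X ^ k)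
    (n : ℕ) :
    ∑ k ∈ Finset.range (n + 1), u k = ∑ i ∈ Finset.range (r + 1),
      (-1) ^ i * (∑ k ∈ Finset.Icc i r, (-1) ^ k * h k * (k.choose i : ℤ)) *
        ((n + r - i).choose (r - i) : ℤ) := by
  have hne : ((1 - X : ℤ⟦X⟧) ^ (r + 1)) ≠ 0 := by
    refine pow_ne_zero _ fun h => ?_
    have := congrArg constantCoeff h
    simp at this
  have key : (PowerSeries.mk fun n => ∑ k ∈ Finset.range (n + 1), u k) =
      PowerSeries.mk fun n => ∑ i ∈ Finset.range (r + 1),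
        (-1) ^ i * (∑ k ∈ Finset.Icc i r, (-1) ^ k * h k * (k.choose i : ℤ)) *
          ((n + r - i).choose (r - i) : ℤ) := by
    -- After multiplication by (1 - t)^{r+1} both sides are the numerator, written in powers of 1 -
    -- t.
    refine mul_right_cancel₀ hne ?_
    rw [pow_succ', ← mul_assoc, mk_mul_one_sub_X (v := u) (by simp)
      (fun n => Finset.sum_range_succ _ _), hu, sum_mul_X_pow_eq]
    have h2 : (PowerSeries.mk fun n => ∑ i ∈ Finset.range (r + 1),
        (-1) ^ i * (∑ k ∈ Finset.Icc i r, (-1) ^ k * h k * (k.choose i : ℤ)) *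
          ((n + r - i).choose (r - i) : ℤ)) = ∑ i ∈ Finset.range (r + 1),
        C ((-1) ^ i * (∑ k ∈ Finset.Icc i r, (-1) ^ k * h k * (k.choose i : ℤ))) *
          PowerSeries.mk fun n => ((n + r - i).choose (r - i) : ℤ) := by
      ext n
      rw [map_sum, coeff_mk]
      refine Finset.sum_congr rfl fun i _ => ?_
      rw [coeff_C_mul, coeff_mk]
    rw [h2, Finset.sum_mul]
    refine Finset.sum_congr rfl fun i hi => ?_
    have hi := Finset.mem_range.1 hi
    have h3 : (PowerSeries.mk fun n => ((n + r - i).choose (r - i) : ℤ)) *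
        (1 - X) ^ (r - i + 1) = 1 := by
      have h4 : (fun n => ((n + r - i).choose (r - i) : ℤ)) =
          fun n => ((r - i + n).choose (r - i) : ℤ) := by
        funext n
        rw [show n + r - i = r - i + n by omega]
      rw [h4, mk_add_choose_mul_one_sub_pow_eq_one]
    rw [← pow_succ', show r + 1 = r - i + 1 + i by omega, pow_add, mul_assoc,
      ← mul_assoc (PowerSeries.mk _), h3, one_mul]
  have := congrArg (coeff n) key
  rwa [coeff_mk, coeff_mk] at this

end Series

/-- The `h_k` vanish if the combinations `∑ (-1)^k h_k binom(k, i)` do. -/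
lemma eq_zero_of_sum_choose_eq_zero {r : ℕ} {h : ℕ → ℤ}
    (hj : ∀ i, 1 ≤ i → i ≤ r → ∑ k ∈ Finset.Icc i r, (-1) ^ k * h k * (k.choose i : ℤ) = 0)
    (i : ℕ) (hi : 1 ≤ i) (hir : i ≤ r) : h i = 0 := by
  -- Descent from i = r: once the higher h_k vanish, only ±h_i survives in the i-th sum.
  induction hm : r - i using Nat.strong_induction_on generalizing i with
  | _ m ih =>
    have h1 := hj i hi hir
    rw [Finset.sum_eq_single i] at h1
    · simpa using h1
    · intro k hk hki
      rw [Finset.mem_Icc] at hk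
      rw [ih (r - k) (by omega) k (by omega) hk.2 rfl, mul_zero, zero_mul]
    · intro h
      exact absurd (Finset.mem_Icc.2 ⟨le_rfl, hir⟩) h

end

end JTransform

/-! ### The 𝐣-polynomial and the criterion for regularity -/

theorem mainTheorem4 {R : Type*} [CommRing R] [IsNoetherianRing R] [IsLocalRing R]
    {M : Type*} [AddCommGroup M] [Module R M] [Module.Finite R M]
    (hd : 0 < Module.supportDim R M) {r : ℕ} (x : Fin r → R)
    (hx : JTransform.IsPartialSOP x M) (ha : JTransform.IsAmenable x M)
    (hs : JTransform.IsDSequence x M) :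
    -- the lengths involved are finite
    IsFiniteLength R (JTransform.localH0 R (JTransform.KoszulHomology x M 0)) ∧
    (∀ n, IsFiniteLength R (JTransform.jComponent (Ideal.span (Set.range x)) M n)) ∧
    -- the Hilbert series
    JTransform.jHilbertSeries (Ideal.span (Set.range x)) M * (1 - PowerSeries.X) ^ r =
      ∑ i ∈ Finset.range (r + 1),
        PowerSeries.C ((-1) ^ i * (JTransform.koszulLength x M i : ℤ)) * PowerSeries.X ^ i ∧
    -- the polynomial and its coefficients
    JTransform.IsJCoeffs x M (JTransform.jCoeff x M) ∧
    (∀ i ≤ r, JTransform.jCoeff x M i =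
      ∑ k ∈ Finset.Icc i r, (-1) ^ k * (JTransform.koszulLength x M k : ℤ) * (k.choose i : ℤ)) ∧
    JTransform.jCoeff x M 0 =
      ∑ k ∈ Finset.range (r + 1), (-1) ^ k * (JTransform.koszulLength x M k : ℤ) ∧
    (1 ≤ r → JTransform.jCoeff x M 1 =
      ∑ k ∈ Finset.Icc 1 r, (-1) ^ k * (k : ℤ) * (JTransform.koszulLength x M k : ℤ)) ∧
    -- the criterion for regularity
    (RingTheory.Sequence.IsRegular M (List.ofFn x) ↔
      ∀ i, 1 ≤ i → i ≤ r → JTransform.jCoeff x M i = 0) := by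
  have hlen : ∀ i, Module.length R (JTransform.KoszulHomology x M (i + 1)) ≠ ⊤ := fun i =>
    Module.length_ne_top_iff.2 (ha (i + 1) i.succ_pos)
  obtain ⟨N, κ, hP, hN, hκ⟩ := hs.exists_hasPresentation hlen
  have h0 : IsFiniteLength R (JTransform.localH0 R (JTransform.KoszulHomology x M 0)) :=
    JTransform.isFiniteLength_localH0
  have hn : ∀ n, IsFiniteLength R (JTransform.jComponent (Ideal.span (Set.range x)) M n) := by
    intro n
    rw [JTransform.jComponent_eq]
    exact JTransform.isFiniteLength_localH0
  have hser : JTransform.jHilbertSeries (Ideal.span (Set.range x)) M * (1 - PowerSeries.X) ^ r =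
      ∑ i ∈ Finset.range (r + 1),
        PowerSeries.C ((-1) ^ i * (JTransform.koszulLength x M i : ℤ)) * PowerSeries.X ^ i := by
    -- Termwise, κ(n) + λ(H_n) = N(n) h₀.
    have h1 : JTransform.jHilbertSeries (Ideal.span (Set.range x)) M =
        PowerSeries.C (JTransform.koszulLength x M 0 : ℤ) * (PowerSeries.mk fun n => (N n : ℤ)) -
          PowerSeries.mk fun n => (κ n : ℤ) := by
      ext n
      have h2 := (hP n).length_jComponent (ENat.natCast_ne_top _)
      obtain ⟨b, hb⟩ := ENat.ne_top_iff_exists.1 (Module.length_ne_top_iff.2 h0)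
      obtain ⟨c, hc⟩ := ENat.ne_top_iff_exists.1 (Module.length_ne_top_iff.2 (hn n))
      rw [← JTransform.length_localH0_koszulHomology_zero, ← hb, ← hc] at h2
      rw [map_sub, PowerSeries.coeff_C_mul]
      simp only [JTransform.jHilbertSeries, PowerSeries.coeff_mk, JTransform.koszulLength,
        if_true, ← hb, ← hc, ENat.toNat_natCast]
      have h3 : κ n + c = N n * b := by exact_mod_cast h2
      have h4 : (κ n : ℤ) + c = N n * b := by exact_mod_cast h3
      linarith
    rw [h1, sub_mul, mul_assoc, hN, hκ, Finset.sum_range_succ', sub_eq_neg_add,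
      ← Finset.sum_neg_distrib]
    congr 1
    · refine Finset.sum_congr rfl fun i _ => ?_
      rw [JTransform.koszulLength, if_neg i.succ_ne_zero, pow_succ (-1 : ℤ) i]
      simp
    · simp
  have hJ : JTransform.IsJCoeffs x M fun i => if i ≤ r then
      ∑ k ∈ Finset.Icc i r, (-1) ^ k * (JTransform.koszulLength x M k : ℤ) * (k.choose i : ℤ)
        else 0 := by
    -- The 𝐣-function agrees with its polynomial for every n, not only for large n.
    refine ⟨fun i hi => if_neg (not_le.2 hi), .of_forall fun n => ?_⟩
    rw [JTransform.jFunction, Nat.cast_sum]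
    refine (JTransform.sum_range_eq_of_mul_one_sub_X_pow hser n).trans ?_
    refine Finset.sum_congr rfl fun i hi => ?_
    simp only [if_pos (Nat.lt_succ_iff.1 (Finset.mem_range.1 hi))]
  have hj : ∀ i ≤ r, JTransform.jCoeff x M i =
      ∑ k ∈ Finset.Icc i r, (-1) ^ k * (JTransform.koszulLength x M k : ℤ) * (k.choose i : ℤ) :=
    fun i hi => (congrFun hJ.jCoeff_eq i).trans (if_pos hi)
  refine ⟨h0, hn, hser, hJ.jCoeff_eq.symm ▸ hJ, hj, ?_, fun hr => ?_, ?_⟩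
  · rw [hj 0 r.zero_le]
    refine Finset.sum_congr (by ext; simp) fun k _ => ?_
    rw [Nat.choose_zero_right, Nat.cast_one, mul_one]
  · rw [hj 1 hr]
    refine Finset.sum_congr rfl fun k _ => ?_
    rw [Nat.choose_one_right]
    ring
  · have hM : Nontrivial M := by
      by_contra h
      rw [not_nontrivial_iff_subsingleton] at h
      rw [Module.supportDim_eq_bot_of_subsingleton] at hd
      exact absurd hd (by simp)
    -- By Nakayama, (x)M ≠ M, so only weak regularity is at stake.
    rw [IsLocalRing.isRegular_iff_isWeaklyRegular_of_subset_maximalIdeal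
      (fun a ha => by
        obtain ⟨i, rfl⟩ := (List.mem_ofFn' _ _).1 ha
        exact hx.1 i), hs.isWeaklyRegular_iff]
    constructor
    · intro h i hi hir
      rw [hj i hir]
      refine Finset.sum_eq_zero fun k hk => ?_
      obtain ⟨k, rfl⟩ := Nat.exists_eq_succ_of_ne_zero
        (show k ≠ 0 by have := (Finset.mem_Icc.1 hk).1; omega)
      rw [JTransform.koszulLength, if_neg k.succ_ne_zero, hs.length_koszulHomology_eq_zero h]
      simp
    · intro h
      rcases Nat.eq_zero_or_pos r with rfl | hr
      · exact JTransform.length_koszulHomology_eq_zero_of_lt one_pos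
      have h1 := JTransform.eq_zero_of_sum_choose_eq_zero
        (fun i hi hir => (hj i hir).symm.trans (h i hi hir)) 1 le_rfl hr
      -- A zero `toNat` may come from ⊤; finiteness of the length of H₁ excludes this.
      rw [JTransform.koszulLength, if_neg one_ne_zero, Int.natCast_eq_zero,
        ENat.toNat_eq_zero] at h1
      exact h1.resolve_right (hlen 0)
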